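/- **Setting.** Let $\mathrm{SU}(2)$ be the group of special unitary $2\times 2$ complex matrices, and let $$X_0=\tfrac12\begin{pmatrix} i&0\\0&-i\end{pmatrix},\quad X_1=\tfrac12\begin{pmatrix}0&1\\-1&0\end{pmatrix},\quad X_2=\tfrac12\begin{pmatrix}0&i\\ i&0\end{pmatrix}$$ be the usual basis of $\mathfrak{su}(2)$, extended to left-invariant vector fields. Let $\langle\cdot,\cdot\rangle$ be the left-invariant metric for which $X_1,X_2,X_0$ is orthonormal; it is used to identify vectors and covectors, so that a covector at $q$ is $\lambda_0=u_0X_1(q)+v_0X_2(q)+w_0X_0(q)$ and $|\lambda_0|^2=u_0^2+v_0^2+w_0^2$. Consider the left-invariant sub-Riemannian structure on $\mathrm{SU}(2)$ for which $X_1,X_2$ is an orthonormal frame. Its Hamiltonian is $H(q,\lambda_0)=\frac12(u_0^2+v_0^2)$. For $q\in\mathrm{SU}(2)$ the exponential map $\exp_q$ sends $\lambda_0$ to the base point at time $1$ of the solution of Hamilton's equation $\dot\lambda=\overrightarrow H(\lambda)$ in $T^*\mathrm{SU}(2)$ (canonical symplectic form) that starts at $(q,\lambda_0)$, and $\mathrm{Conj}_q$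 is the set of $\lambda_0\in T_q^*\mathrm{SU}(2)$ at which $\ker d_{\lambda_0}\exp_q\neq\{0\}$. Put $$C^0=\{\lambda_0\in T_q^*\mathrm{SU}(2)\setminus\{0\} : |\lambda_0|\cos(|\lambda_0|/2)=2\sin(|\lambda_0|/2)\},$$ $$C^1=\{\lambda_0\in T_q^*\mathrm{SU}(2)\setminus\{0\} : \sin(|\lambda_0|/2)=0\}.$$ For $f:\mathbb R^3\to\mathbb R^3$, say that $\exp_q$ is *equivalent to $f$ near $\lambda_0$* if there are smooth coordinate charts of $T_q^*\mathrm{SU}(2)$ centred at $\lambda_0$ and of $\mathrm{SU}(2)$ centred at $\exp_q(\lambda_0)$ in which $\exp_q$ is represented by $f$. **Theorem.** Let $q\in\mathrm{SU}(2)$. The map $\exp_q$ is defined on all of $T_q^*\mathrm{SU}(2)$, and a covector $\lambda_0$ with $H(q,\lambda_0)\neq0$ lies in $\mathrm{Conj}_q$ if and only if $\lambda_0\in C^0\cup C^1$. Moreover: 1. there is a non-empty dense subset $D$ of $C^0$ such that, near every $\lambda_0\in D$, $\exp_q$ is equivalent to $(x,y,z)\mapsto(x^2,y,z)$; 2. near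 every $\lambda_0\in C^1$ with $H(q,\lambda_0)\neq 0$, $\exp_q$ is equivalent to $(x,y,z)\mapsto(xz,y,z)$. -/

import Mathlib

open Set
open scoped ContDiff Matrix

/-- The ambient space `M₂(ℂ)`, a real vector space of dimension 8. -/
abbrev Mat2 : Type := Matrix (Fin 2) (Fin 2) ℂ

-- A norm on `M₂(ℂ)`, used only for calculus (all norms are equivalent); it induces the usual
-- topology. The Riemannian inner product used below is `ip`, not this norm.
attribute [local instance] Matrix.normedAddCommGroup Matrix.normedSpace

/-- The group `SU(2)`, an embedded submanifold of `M₂(ℂ)`. -/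
abbrev SU2 : Type := Matrix.specialUnitaryGroup (Fin 2) ℂ

namespace SRSU2

noncomputable section

/-- The Lie algebra `𝔰𝔲(2)`: antihermitian traceless matrices. -/
def su2 : Submodule ℝ Mat2 where
  carrier := {A | Aᴴ = -A ∧ A.trace = 0}
  add_mem' := by
    rintro A B ⟨hA, hA'⟩ ⟨hB, hB'⟩
    refine ⟨?_, by rw [Matrix.trace_add, hA', hB', add_zero]⟩
    rw [Matrix.conjTranspose_add, hA, hB, neg_add]
  zero_mem' := by simp
  smul_mem' := by
    rintro c A ⟨hA, hA'⟩
    refine ⟨?_, by rw [Matrix.trace_smul, hA', smul_zero]⟩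
    rw [Matrix.conjTranspose_smul, hA, star_trivial, smul_neg]

/-- `X₀`. -/
def X0 : Mat2 := (1 / 2 : ℂ) • !![Complex.I, 0; 0, -Complex.I]

/-- `X₁`. -/
def X1 : Mat2 := (1 / 2 : ℂ) • !![0, 1; -1, 0]

/-- `X₂`. -/
def X2 : Mat2 := (1 / 2 : ℂ) • !![0, Complex.I; Complex.I, 0]

/-- The inner product `⟨A, B⟩ = 2 Re tr(A* B)`. On `𝔰𝔲(2)` it is the one for which
`X₁, X₂, X₀` is an orthonormal basis, and it is invariant under left translation by `SU(2)`. -/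
def ip (A B : Mat2) : ℝ := 2 * (Aᴴ * B).trace.re

theorem ip_orthonormal :
    ip X0 X0 = 1 ∧ ip X1 X1 = 1 ∧ ip X2 X2 = 1 ∧
      ip X0 X1 = 0 ∧ ip X0 X2 = 0 ∧ ip X1 X2 = 0 := by
  refine ⟨?_, ?_, ?_, ?_, ?_, ?_⟩ <;>
    simp [ip, X0, X1, X2, Matrix.trace_fin_two, Matrix.mul_apply, Fin.sum_univ_two] <;> norm_num

theorem ip_left_invariant (g : SU2) (A B : Mat2) :
    ip ((g : Mat2) * A) ((g : Mat2) * B) = ip A B := by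
  have h : (g : Mat2)ᴴ * (g : Mat2) = 1 :=
    (Matrix.mem_unitaryGroup_iff'.1 (Matrix.mem_specialUnitaryGroup_iff.1 g.2).1)
  have : ((g : Mat2) * A)ᴴ * ((g : Mat2) * B) = Aᴴ * B := by
    rw [Matrix.conjTranspose_mul, Matrix.mul_assoc, ← Matrix.mul_assoc _ (g : Mat2) B, h,
      Matrix.one_mul]
  rw [ip, ip, this]

/-- The tangent space of `SU(2)` at `g`, i.e. the left translate `g 𝔰𝔲(2)`. The metric `ip`
identifies vectors and covectors, so that this is also the cotangent space at `g`: the element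
`P` stands for the covector `V ↦ ⟨P, V⟩`. -/
def cotangentSpace (g : Mat2) : Submodule ℝ Mat2 := su2.map (LinearMap.mulLeft ℝ g)

/-- The cotangent bundle `T*SU(2)`, as a submanifold of `M₂(ℂ) × M₂(ℂ)`: pairs `(g, P)` with
`g ∈ SU(2)` and `P` a covector at `g`. -/
def cotangentBundle : Set (Mat2 × Mat2) :=
  {x | x.1 ∈ Matrix.specialUnitaryGroup (Fin 2) ℂ ∧ x.2 ∈ cotangentSpace x.1}

/-- The canonical symplectic form of `T*SU(2)`. The Liouville one-form is
`s_(g,P)(V) = ⟨P, V.1⟩`, and `σ = ds` is the restriction to `T*SU(2)` of this constant form. -/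
def symplecticForm (V W : Mat2 × Mat2) : ℝ := ip V.2 W.1 - ip W.2 V.1

/-- The sub-Riemannian Hamiltonian `H(g, P) = (⟨P, X₁(g)⟩² + ⟨P, X₂(g)⟩²) / 2`, where
`X_k(g) = g X_k` are the left-invariant vector fields generating the structure. -/
def hamiltonian (x : Mat2 × Mat2) : ℝ :=
  (1 / 2) * (ip x.2 (x.1 * X1) ^ 2 + ip x.2 (x.1 * X2) ^ 2)

/-- `c` is a curve in `T*SU(2)` with `c 0 = x` and velocity `V` at `0`. -/
def IsCurveWithVelocity (c : ℝ → Mat2 × Mat2) (x V : Mat2 × Mat2) : Prop :=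
  (∀ s, c s ∈ cotangentBundle) ∧ c 0 = x ∧ HasDerivAt c V 0

/-- `W` is the value at `x` of the Hamiltonian vector field of `H`: it is tangent to `T*SU(2)`
at `x`, and `σ(V, W) = d_x H (V)` for every vector `V` tangent to `T*SU(2)` at `x`. -/
def IsHamiltonianVector (x W : Mat2 × Mat2) : Prop :=
  (∃ c, IsCurveWithVelocity c x W) ∧
    ∀ c V, IsCurveWithVelocity c x V →
      HasDerivAt (fun s => hamiltonian (c s)) (symplecticForm V W) 0

/-- `x` is a normal extremal on `[0, 1]`, i.e. a solution of Hamilton's equation in `T*SU(2)`. -/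
def IsNormalExtremal (x : ℝ → Mat2 × Mat2) : Prop :=
  ∀ t ∈ Icc (0 : ℝ) 1, x t ∈ cotangentBundle ∧
    ∃ W, IsHamiltonianVector (x t) W ∧ HasDerivWithinAt x W (Icc 0 1) t

/-- The set `𝒜_q` of covectors at `q` whose normal extremal is defined on `[0, 1]`. -/
def expDomain (q : SU2) : Set (cotangentSpace q) :=
  {p | ∃ x, IsNormalExtremal x ∧ x 0 = ((q : Mat2), (p : Mat2))}

open Classical in
/-- The sub-Riemannian exponential map at `q`: the base point at time `1` of the normal extremal
starting at `(q, p)`. (Outside `𝒜_q` it takes the value `q`.) -/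
def srExp (q : SU2) (p : cotangentSpace q) : SU2 :=
  if h : p ∈ expDomain q then
    ⟨(h.choose 1).1, (h.choose_spec.1 1 (right_mem_Icc.2 zero_le_one)).1.1⟩
  else q

/-- The conjugate locus at `q`: covectors at which the differential of `exp_q` has a nontrivial
kernel. -/
def conjugateLocus (q : SU2) : Set (cotangentSpace q) :=
  {p | p ∈ expDomain q ∧ ∃ L : cotangentSpace q →L[ℝ] Mat2,
    HasFDerivAt (fun p' => (srExp q p' : Mat2)) L p ∧ LinearMap.ker L.toLinearMap ≠ ⊥}

/-- The length `|p|` of a covector. -/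
def covNorm (q : SU2) (p : cotangentSpace q) : ℝ := Real.sqrt (ip p p)

/-- The stratum `C⁰`. -/
def C0 (q : SU2) : Set (cotangentSpace q) :=
  {p | p ≠ 0 ∧ covNorm q p * Real.cos (covNorm q p / 2) = 2 * Real.sin (covNorm q p / 2)}

/-- The stratum `C¹`. -/
def C1 (q : SU2) : Set (cotangentSpace q) :=
  {p | p ≠ 0 ∧ Real.sin (covNorm q p / 2) = 0}

/-- Smooth coordinate charts of the vector space `T*_q SU(2)`. -/
def IsCovectorChart (q : SU2) (χ : OpenPartialHomeomorph (cotangentSpace q) (ℝ × ℝ × ℝ)) : Prop :=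
  ContDiffOn ℝ ∞ χ χ.source ∧ ContDiffOn ℝ ∞ χ.symm χ.target

/-- Smooth coordinate charts of the embedded submanifold `SU(2)` of `M₂(ℂ)`: the inverse of the
chart is smooth as a map into `M₂(ℂ)`, and the chart is near each point of its source the
restriction of a smooth map defined on an open subset of `M₂(ℂ)`. -/
def IsGroupChart (ψ : OpenPartialHomeomorph SU2 (ℝ × ℝ × ℝ)) : Prop :=
  ContDiffOn ℝ ∞ (fun y => (ψ.symm y : Mat2)) ψ.target ∧
    ∀ g ∈ ψ.source, ∃ U : Set Mat2, IsOpen U ∧ (g : Mat2) ∈ U ∧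
      ∃ F : Mat2 → ℝ × ℝ × ℝ, ContDiffOn ℝ ∞ F U ∧
        ∀ h ∈ ψ.source, (h : Mat2) ∈ U → ψ h = F h

/-- Near `p`, the map `exp_q` is equivalent to `f : ℝ³ → ℝ³`: there are smooth coordinate charts
centred at `p` and at `exp_q(p)` in which `exp_q` is represented by `f`. -/
def ExpEquivalentAt (q : SU2) (p : cotangentSpace q) (f : ℝ × ℝ × ℝ → ℝ × ℝ × ℝ) : Prop :=
  ∃ (χ : OpenPartialHomeomorph (cotangentSpace q) (ℝ × ℝ × ℝ))
    (ψ : OpenPartialHomeomorph SU2 (ℝ × ℝ × ℝ)),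
    IsCovectorChart q χ ∧ IsGroupChart ψ ∧
    p ∈ χ.source ∧ χ p = 0 ∧ srExp q p ∈ ψ.source ∧ ψ (srExp q p) = 0 ∧
    MapsTo (srExp q) χ.source ψ.source ∧
    ∀ y ∈ χ.target, ψ (srExp q (χ.symm y)) = f y

end

end SRSU2

namespace SRSU2

noncomputable section

/-! ### Smooth analysis: parametric integrals, local diffeomorphisms, folds -/

open Filter Topology MeasureTheory

section Analysis

variable {E F : Type*} [NormedAddCommGroup E] [NormedSpace ℝ E]
  [NormedAddCommGroup F] [NormedSpace ℝ F]

/-! Everything rests on an explicit formula. Identify `SU(2)` with the unit vectors `(a, b)` of `ℂ²`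
(first rows) and, by left translation, a covector with `(z, w)`, `z = u + iv`, of length `r`. Along
an extremal `w` is constant and `z` turns as `z e^{iwt}`, and Hamilton's equation integrates to `a =
(cos (r/2) + i (w/r) sin (r/2)) e^{-iw/2}` and `b = z s(r) e^{iw/2}` at time `1`, where `s(r) = sin
(r/2) / r` (`exists_integralCurve`). To know that `srExp` is this map (`srExp_eq`), one checks that
the Hamiltonian vector defined by the symplectic form is `hamField` and nothing else
(`isHamiltonianVector_hamField`, `IsHamiltonianVector.eq_hamField`), and applies uniqueness for ODEs
(`IsNormalExtremal.eqOn`).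

Conjugate points: the kernel equations of the differential carry the factors `s` and `s'`
(`rowDeriv_eq_zero_iff`). If neither vanishes, what remains is a linear system of determinant `r² -
w² = |z|²` up to sign, so the kernel is trivial when `z ≠ 0`. The condition `s' = 0` is `C⁰`, the
condition `s = 0` is `C¹`, and each gives an explicit kernel vector (`exists_rowDeriv_eq_zero_iff`).

Near `C¹`, `b = s(r) ζ` with `ζ` nonvanishing. After unit rotations of `a` and `b` that make `ζ`
positive at the point, `Im b = Re b · (Im ζ / Re ζ)`, while `(Im ζ / Re ζ, Im a, Re b)` is a
coordinate system upstairs: this is `(xz, y, z)` (`expEquivalentAt_of_mem_C1`).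

Near a point of `C⁰` with `z ≠ 0` and `w ≠ 0`, the pair `(r, b)` is a coordinate system, and `|a|² =
1 - |b|²`, so that for fixed `b` only the argument of `a` moves with `r`. Its `r`-derivative is a
nonvanishing factor times `2 sin (r/2) - r cos (r/2)`, which has a simple zero; completing the
square gives the fold (`hasDerivAt_entryFn`, `exists_sq_eq_of_fold`, `expEquivalentAt_of_mem_C0`).
As `C⁰` is a union of spheres about `0`, removing poles and equators leaves a dense subset
(`C0_subset_closure_foldPoints`). -/

/-- Integrals over `[0, 1]` of smooth functions depend smoothly on parameters. -/
theorem contDiff_integral_unitInterval {f : E × ℝ → ℝ} (hf : ContDiff ℝ ∞ f) :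
    ContDiff ℝ ∞ (fun p => ∫ t in (0 : ℝ)..1, f (p, t)) := by
  -- The integral is the value at `0` of the convolution of the indicator of `(0, 1]` with `y ↦ f
  -- (p, -y)`; the cut-off `φ`, equal to `1` on `[-1, 1]`, supplies the compact support.
  let φ : ContDiffBump (0 : ℝ) := ⟨1, 2, one_pos, one_lt_two⟩
  let g : E → ℝ → ℝ := fun p y => φ y * f (p, -y)
  have hg : ContDiff ℝ ∞ (fun x : E × ℝ => g x.1 x.2) :=
    (φ.contDiff.comp contDiff_snd).mul (hf.comp (contDiff_fst.prodMk contDiff_snd.neg))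
  have hloc : LocallyIntegrable ((Ioc (0 : ℝ) 1).indicator (fun _ => (1 : ℝ))) volume :=
    ((integrableOn_const (by simp)).integrable_indicator measurableSet_Ioc).locallyIntegrable
  have key := contDiffOn_convolution_right_with_param (μ := volume) (n := ⊤)
    (ContinuousLinearMap.mul ℝ ℝ) (g := g)
    (s := univ) isOpen_univ (isCompact_closedBall (0 : ℝ) 2)
    (fun p x _ hx => by
      have : φ x = 0 := φ.zero_of_le_dist (by
        rw [Metric.mem_closedBall, not_le] at hx; exact hx.le)
      simp [g, this]) hloc hg.contDiffOn
  rw [univ_prod_univ, contDiffOn_univ] at key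
  have h2 := key.comp (contDiff_id.prodMk (contDiff_const (c := (0 : ℝ))) :
    ContDiff ℝ ∞ (fun p : E => (p, (0 : ℝ))))
  convert h2 using 1
  ext p
  rw [intervalIntegral.integral_of_le zero_le_one, ← integral_indicator measurableSet_Ioc]
  simp only [Function.comp, convolution]
  congr 1
  ext t
  by_cases ht : t ∈ Ioc (0 : ℝ) 1
  · have : φ (-t) = 1 := φ.one_of_mem_closedBall (by
      simp only [Metric.mem_closedBall, dist_zero_right, norm_neg, Real.norm_eq_abs]
      rw [abs_of_pos ht.1]; exact ht.2)
    simp [ht, g, this]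
  · simp [ht]

/-- A smooth function on a neighbourhood of a point coincides near it with a global one. -/
theorem exists_contDiff_eqOn_ball [FiniteDimensional ℝ E] {f : E → ℝ} {U : Set E} {a : E}
    (hU : IsOpen U) (ha : a ∈ U) (hf : ContDiffOn ℝ ∞ f U) :
    ∃ ε > 0, ∃ g : E → ℝ, ContDiff ℝ ∞ g ∧ Metric.ball a ε ⊆ U ∧ EqOn g f (Metric.ball a ε) := by
  obtain ⟨ε, hε, hεU⟩ := Metric.isOpen_iff.1 hU a ha
  let φ : ContDiffBump a := ⟨ε / 3, ε / 2, by positivity, by linarith⟩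
  have hsub : tsupport φ ⊆ U := by
    rw [φ.tsupport_eq]
    exact (Metric.closedBall_subset_ball (by change ε / 2 < ε; linarith)).trans hεU
  refine ⟨ε / 3, by positivity, fun x => φ x * f x, ?_,
    (Metric.ball_subset_ball (by linarith)).trans hεU, fun x hx => ?_⟩
  · rw [contDiff_iff_contDiffAt]
    intro x
    by_cases hx : x ∈ tsupport φ
    · exact φ.contDiff.contDiffAt.mul (hf.contDiffAt (hU.mem_nhds (hsub hx)))
    · refine (contDiffAt_const (c := (0 : ℝ))).congr_of_eventuallyEq ?_
      filter_upwards [(isClosed_tsupport φ).isOpen_compl.mem_nhds hx] with y hy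
      rw [image_eq_zero_of_notMem_tsupport hy, zero_mul]
  · have : φ x = 1 := φ.one_of_mem_closedBall (Metric.ball_subset_closedBall hx)
    simp [this]

/-- Fold coordinates: if `∂ₓτ` vanishes on `x = 0` to first order exactly, then up to a constant
factor `τ(x, Y) - τ(0, Y)` is the square of a function with nonzero `x`-derivative. -/
theorem exists_sq_eq_of_fold [FiniteDimensional ℝ E] {τ τ₁ : ℝ × E → ℝ} {U : Set (ℝ × E)}
    (hU : IsOpen U) (h0 : 0 ∈ U) (hτ₁ : ContDiffOn ℝ ∞ τ₁ U)
    (hd : ∀ p ∈ U, HasDerivAt (fun x => τ (x, p.2)) (τ₁ p) p.1)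
    (hz : ∀ Y, (0, Y) ∈ U → τ₁ (0, Y) = 0) {d : ℝ} (hd0 : d ≠ 0)
    (hdd : HasDerivAt (fun x => τ₁ (x, 0)) d 0) :
    ∃ (s : ℝ) (X : ℝ × E → ℝ) (V : Set (ℝ × E)) (c : ℝ), s ≠ 0 ∧ IsOpen V ∧ 0 ∈ V ∧
      (∀ p ∈ V, p ∈ U ∧ (0, p.2) ∈ U) ∧ ContDiffOn ℝ ∞ X V ∧ c ≠ 0 ∧
      (∀ Y, X (0, Y) = 0) ∧
      HasDerivAt (fun x => X (x, 0)) c 0 ∧ ∀ p ∈ V, s * (τ p - τ (0, p.2)) = X p ^ 2 := by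
  obtain ⟨ε, hε, T, hT, hεU, hTτ⟩ := exists_contDiff_eqOn_ball hU h0 hτ₁
  have hball : ∀ p ∈ Metric.ball (0 : ℝ × E) ε, ∀ t ∈ Icc (0 : ℝ) 1,
      (t * p.1, p.2) ∈ Metric.ball (0 : ℝ × E) ε := by
    intro p hp t ht
    simp only [Metric.mem_ball, dist_zero_right, Prod.norm_def, max_lt_iff] at hp ⊢
    refine ⟨lt_of_le_of_lt ?_ hp.1, hp.2⟩
    rw [norm_mul, Real.norm_eq_abs t, abs_of_nonneg ht.1]
    exact mul_le_of_le_one_left (norm_nonneg _) ht.2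
  -- Hadamard's lemma twice: `τ₁ = x * e` because `τ₁` vanishes at `x = 0`, and then `τ - τ (0, ·) =
  -- x ^ 2 * k`, with `k 0 = d / 2`.
  let dT : ℝ × E → ℝ := fun p => fderiv ℝ T p (1, 0)
  have hdT : ContDiff ℝ ∞ dT :=
    (hT.fderiv_right (m := ∞) (by simp)).clm_apply contDiff_const
  have hdTd : ∀ p : ℝ × E, HasDerivAt (fun x => T (x, p.2)) (dT p) p.1 := by
    intro p
    have h1 : HasFDerivAt T (fderiv ℝ T p) (p.1, p.2) :=
      (hT.differentiable (by simp) p).hasFDerivAt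
    exact h1.comp_hasDerivAt p.1 ((hasDerivAt_id _).prodMk (hasDerivAt_const _ _))
  let e : ℝ × E → ℝ := fun p => ∫ t in (0 : ℝ)..1, dT (t * p.1, p.2)
  have he : ContDiff ℝ ∞ e := contDiff_integral_unitInterval
    (f := fun p : (ℝ × E) × ℝ => dT (p.2 * p.1.1, p.1.2)) (hdT.comp (by fun_prop))
  let k : ℝ × E → ℝ := fun p => ∫ t in (0 : ℝ)..1, t * e (t * p.1, p.2)
  have hk : ContDiff ℝ ∞ k := contDiff_integral_unitInterval
    (f := fun p : (ℝ × E) × ℝ => p.2 * e (p.2 * p.1.1, p.1.2))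
    (contDiff_snd.mul (he.comp (by fun_prop)))
  have he1 : ∀ p ∈ Metric.ball (0 : ℝ × E) ε, τ₁ p = p.1 * e p := by
    intro p hp
    have h1 : ∫ t in (0 : ℝ)..1, p.1 * dT (t * p.1, p.2) = T (1 * p.1, p.2) - T (0 * p.1, p.2) := by
      refine intervalIntegral.integral_eq_sub_of_hasDerivAt (f := fun t => T (t * p.1, p.2))
        (fun t _ => ?_) ?_
      · have := (hdTd (t * p.1, p.2)).comp t ((hasDerivAt_id t).mul_const p.1)
        simpa [Function.comp_def, mul_comm] using this
      · exact (continuous_const.mul (hdT.continuous.comp (by fun_prop))).intervalIntegrable _ _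
    rw [intervalIntegral.integral_const_mul] at h1
    have h2 := hball p hp 0 (by simp)
    rw [zero_mul] at h2
    rw [show p.1 * e p = _ from h1, one_mul, zero_mul, hTτ hp, hTτ h2, hz _ (hεU h2), sub_zero]
  have hk1 : ∀ p ∈ Metric.ball (0 : ℝ × E) ε, τ p - τ (0, p.2) = p.1 ^ 2 * k p := by
    intro p hp
    have h1 : ∫ t in (0 : ℝ)..1, p.1 ^ 2 * (t * e (t * p.1, p.2)) =
        τ (1 * p.1, p.2) - τ (0 * p.1, p.2) := by
      refine intervalIntegral.integral_eq_sub_of_hasDerivAt (f := fun t => τ (t * p.1, p.2))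
        (fun t ht => ?_) ?_
      · rw [uIcc_of_le zero_le_one] at ht
        have hb := hball p hp t ht
        have := (hd _ (hεU hb)).comp t ((hasDerivAt_id t).mul_const p.1)
        rw [he1 _ hb] at this
        refine this.congr_deriv ?_
        ring
      · refine Continuous.intervalIntegrable (continuous_const.mul (continuous_id.mul
          (he.continuous.comp (by fun_prop)))) _ _
    rw [intervalIntegral.integral_const_mul, one_mul, zero_mul] at h1
    exact h1.symm
  have he0 : e 0 = d := by
    have h1 : HasDerivAt (fun x => T (x, (0 : E))) d 0 := by
      refine hdd.congr_of_eventuallyEq ?_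
      have : Continuous (fun x : ℝ => (x, (0 : E))) := by fun_prop
      filter_upwards [this.continuousAt.preimage_mem_nhds (Metric.ball_mem_nhds _ hε)] with x hx
      exact hTτ hx
    have h2 : dT 0 = d := (hdTd 0).unique h1
    simp only [e]
    simp [← h2, Prod.zero_eq_mk]
  have hk0 : k 0 = d / 2 := by
    have : ∀ t : ℝ, t * e (t * (0 : ℝ × E).1, (0 : ℝ × E).2) = t * d := by
      intro t; rw [← he0]; simp [Prod.zero_eq_mk]
    simp only [k, this, intervalIntegral.integral_mul_const, integral_id]
    ring
  have hsk : Continuous fun p => d * k p := continuous_const.mul hk.continuous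
  have hX : ContDiffOn ℝ ∞ (fun p : ℝ × E => p.1 * Real.sqrt (d * k p))
      (Metric.ball 0 ε ∩ {p | 0 < d * k p}) := by
    refine contDiff_fst.contDiffOn.mul ?_
    intro p hp
    exact ((contDiff_const.mul hk).contDiffAt.sqrt hp.2.ne').contDiffWithinAt
  -- Scaling by `d` makes `d * k 0 = d ^ 2 / 2` positive whatever the sign of `d`, so the square
  -- root is smooth near `0`.
  refine ⟨d, fun p => p.1 * Real.sqrt (d * k p), Metric.ball 0 ε ∩ {p | 0 < d * k p},
    Real.sqrt (d * k 0), hd0, Metric.isOpen_ball.inter (isOpen_lt continuous_const hsk),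
    ⟨Metric.mem_ball_self hε, ?_⟩, ?_, hX, ?_, by simp, ?_, ?_⟩
  · change 0 < d * k 0
    rw [hk0, ← mul_div_assoc]
    exact half_pos (mul_self_pos.2 hd0)
  · intro p hp
    refine ⟨hεU hp.1, hεU ?_⟩
    simpa using hball p hp.1 0 (by simp)
  · rw [hk0]
    have : 0 < d * d := mul_self_pos.2 hd0
    exact (Real.sqrt_pos.2 (by linarith)).ne'
  · have hc : ContinuousAt (fun x : ℝ => Real.sqrt (d * k (x, 0))) 0 :=
      (Real.continuous_sqrt.comp (hsk.comp
        (by fun_prop : Continuous fun x : ℝ => (x, (0 : E))))).continuousAt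
    rw [hasDerivAt_iff_tendsto_slope]
    refine (hc.tendsto.mono_left nhdsWithin_le_nhds).congr' ?_
    filter_upwards [self_mem_nhdsWithin] with x hx
    have hx' : x ≠ 0 := hx
    rw [slope_def_field]
    field_simp
    simp
  · intro p hp
    rw [hk1 p hp.1, mul_pow, Real.sq_sqrt hp.2.le]
    ring

/-! ### Local diffeomorphisms -/

/-- A map is a local diffeomorphism at `a` if near `a` it agrees with a homeomorphism of open sets
that is smooth in both directions. -/
def IsLocDiffeo (h : E → F) (a : E) : Prop :=
  ∃ e : OpenPartialHomeomorph E F, a ∈ e.source ∧ ContDiffOn ℝ ∞ e e.source ∧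
    ContDiffOn ℝ ∞ e.symm e.target ∧ EqOn e h e.source

/-- Inverse function theorem, with the source shrunk to the open set where the differential is
invertible: this makes the inverse smooth on the whole target and not only at `h a`. -/
theorem isLocDiffeo_of_hasFDerivAt [CompleteSpace E] {h : E → F} {U : Set E} {a : E}
    (hU : IsOpen U) (ha : a ∈ U) (hh : ContDiffOn ℝ ∞ h U) (h' : E ≃L[ℝ] F)
    (hd : HasFDerivAt h (h' : E →L[ℝ] F) a) : IsLocDiffeo h a := by
  have hA : ContDiffAt ℝ ∞ h a := hh.contDiffAt (hU.mem_nhds ha)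
  let e0 := hA.toOpenPartialHomeomorph h hd (by simp)
  have he0 : ∀ x, e0 x = h x := fun _ => rfl
  let V : Set E := U ∩ fderiv ℝ h ⁻¹' range ((↑) : (E ≃L[ℝ] F) → E →L[ℝ] F)
  have hV : IsOpen V :=
    (hh.continuousOn_fderiv_of_isOpen hU (by simp)).isOpen_inter_preimage hU
      (ContinuousLinearEquiv.isOpen)
  let e := e0.restrOpen V hV
  have hsrc : e.source = e0.source ∩ V := e0.restrOpen_source V hV
  refine ⟨e, ?_, ?_, ?_, ?_⟩
  · rw [hsrc]
    exact ⟨hA.mem_toOpenPartialHomeomorph_source hd (by simp), ha, h', hd.fderiv.symm⟩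
  · exact hh.mono (by rw [hsrc]; exact fun x hx => hx.2.1)
  · intro y hy
    have hx := e.map_target hy
    rw [hsrc] at hx
    obtain ⟨L, hL⟩ := hx.2.2
    have hc : ContDiffAt ℝ ∞ h (e.symm y) := hh.contDiffAt (hU.mem_nhds hx.2.1)
    refine (e.contDiffAt_symm (f₀' := L) hy ?_ hc).contDiffWithinAt
    rw [hL]
    exact (hc.differentiableAt (by simp)).hasFDerivAt
  · exact fun x _ => rfl

theorem isLocDiffeo_of_injective [FiniteDimensional ℝ E] [FiniteDimensional ℝ F]
    (hdim : Module.finrank ℝ E = Module.finrank ℝ F) {h : E → F} {U : Set E} {a : E}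
    (hU : IsOpen U) (ha : a ∈ U) (hh : ContDiffOn ℝ ∞ h U)
    (hker : ∀ v, fderiv ℝ h a v = 0 → v = 0) : IsLocDiffeo h a := by
  have hinj : Function.Injective (fderiv ℝ h a : E →ₗ[ℝ] F) := by
    rw [← LinearMap.ker_eq_bot, LinearMap.ker_eq_bot']
    exact hker
  let L : E ≃L[ℝ] F := (LinearEquiv.ofInjectiveOfFinrankEq (fderiv ℝ h a : E →ₗ[ℝ] F) hinj
    hdim).toContinuousLinearEquiv
  have := FiniteDimensional.complete ℝ E
  refine isLocDiffeo_of_hasFDerivAt hU ha hh L ?_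
  have : (L : E →L[ℝ] F) = fderiv ℝ h a := by ext x; rfl
  rw [this]
  exact ((hh.contDiffAt (hU.mem_nhds ha)).differentiableAt (by simp)).hasFDerivAt

/-- The chain rule for `g ∘ h = id` makes the differential of `h` injective; differentiability of
`g` at one point is enough. -/
theorem isLocDiffeo_of_leftInverse [FiniteDimensional ℝ E] [FiniteDimensional ℝ F]
    (hdim : Module.finrank ℝ E = Module.finrank ℝ F) {h : E → F} {U : Set E} {a : E}
    (hU : IsOpen U) (ha : a ∈ U) (hh : ContDiffOn ℝ ∞ h U) {g : F → E}
    (hg : DifferentiableAt ℝ g (h a)) (hgh : ∀ᶠ x in 𝓝 a, g (h x) = x) : IsLocDiffeo h a := by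
  refine isLocDiffeo_of_injective hdim hU ha hh fun v hv => ?_
  have h1 : HasFDerivAt h (fderiv ℝ h a) a :=
    ((hh.contDiffAt (hU.mem_nhds ha)).differentiableAt (by simp)).hasFDerivAt
  have h2 := hg.hasFDerivAt.comp a h1
  have h3 : HasFDerivAt (g ∘ h) (ContinuousLinearMap.id ℝ E) a :=
    (hasFDerivAt_id a).congr_of_eventuallyEq hgh
  have h4 := congrArg (fun L => L v) (h2.unique h3)
  simpa [hv] using h4.symm

theorem IsLocDiffeo.comp {G : Type*} [NormedAddCommGroup G] [NormedSpace ℝ G] {g : F → G}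
    {h : E → F} {a : E} (hg : IsLocDiffeo g (h a)) (hh : IsLocDiffeo h a) :
    IsLocDiffeo (g ∘ h) a := by
  obtain ⟨e, he, he1, he2, he3⟩ := hh
  obtain ⟨f, hf, hf1, hf2, hf3⟩ := hg
  refine ⟨e.trans f, ?_, ?_, ?_, ?_⟩
  · rw [OpenPartialHomeomorph.trans_source]
    exact ⟨he, by rw [mem_preimage, he3 he]; exact hf⟩
  · rw [OpenPartialHomeomorph.trans_source]
    exact hf1.comp (he1.mono inter_subset_left) fun x hx => hx.2
  · rw [OpenPartialHomeomorph.trans_target]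
    exact he2.comp (hf2.mono inter_subset_left) fun x hx => hx.2
  · rw [OpenPartialHomeomorph.trans_source]
    intro x hx
    change f (e x) = g (h x)
    rw [hf3 hx.2, he3 hx.1]

end Analysis

/-! ### Coordinates on `SU(2)`, `𝔰𝔲(2)` and the cotangent bundle -/

/-- The quaternionic matrix with first row `a`, `b`. -/
def qm (a b : ℂ) : Mat2 := !![a, b; -star b, star a]

/-- `qm` as a real linear map. -/
def qmL : ℂ × ℂ →ₗ[ℝ] Mat2 where
  toFun x := qm x.1 x.2
  map_add' x y := by
    ext i j; fin_cases i <;> fin_cases j <;> simp [qm, add_comm]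
  map_smul' c x := by
    ext i j; fin_cases i <;> fin_cases j <;> simp [qm]

/-- The element `u X₁ + v X₂ + w X₀` of `𝔰𝔲(2)`, with `z = u + i v`. -/
def cov (z : ℂ) (w : ℝ) : Mat2 := qm (Complex.I * w / 2) (z / 2)

theorem qm_mul (a b c d : ℂ) : qm a b * qm c d = qm (a * c - b * star d) (a * d + b * star c) := by
  ext i j; fin_cases i <;> fin_cases j <;> simp [qm, Matrix.mul_apply, Fin.sum_univ_two] <;> ring

theorem conjTranspose_qm (a b : ℂ) : (qm a b)ᴴ = qm (star a) (-b) := by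
  ext i j; fin_cases i <;> fin_cases j <;> simp [qm]

theorem qm_one_zero : qm 1 0 = 1 := by
  ext i j; fin_cases i <;> fin_cases j <;> simp [qm]

theorem mul_star_self (a : ℂ) : a * star a = (Complex.normSq a : ℂ) := Complex.mul_conj a

theorem qm_mem {a b : ℂ} (h : Complex.normSq a + Complex.normSq b = 1) :
    qm a b ∈ Matrix.specialUnitaryGroup (Fin 2) ℂ := by
  have h' : a * star a + b * star b = 1 := by
    rw [mul_star_self, mul_star_self]; exact_mod_cast h
  rw [Matrix.mem_specialUnitaryGroup_iff, Matrix.mem_unitaryGroup_iff]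
  constructor
  · change qm a b * (qm a b)ᴴ = 1
    rw [conjTranspose_qm, qm_mul, ← qm_one_zero]
    congr 1
    · rw [star_neg, mul_neg, sub_neg_eq_add, h']
    · rw [star_star]; ring
  · rw [qm, Matrix.det_fin_two_of, ← h']; ring

/-- For a unitary matrix of determinant `1` the inverse is both the adjoint and the adjugate;
comparing their entries gives the quaternionic form. -/
theorem exists_qm_of_mem {g : Mat2} (hg : g ∈ Matrix.specialUnitaryGroup (Fin 2) ℂ) :
    ∃ a b, Complex.normSq a + Complex.normSq b = 1 ∧ g = qm a b := by
  rw [Matrix.mem_specialUnitaryGroup_iff, Matrix.mem_unitaryGroup_iff] at hg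
  obtain ⟨h1, h2⟩ := hg
  have hadj : star g = g.adjugate := by
    calc star g = (g.adjugate * g) * star g := by rw [Matrix.adjugate_mul, h2, one_smul, one_mul]
      _ = g.adjugate := by rw [mul_assoc, h1, mul_one]
  have e1 := congrFun (congrFun hadj 0) 0
  have e2 := congrFun (congrFun hadj 0) 1
  rw [Matrix.adjugate_fin_two] at e1 e2
  simp only [Matrix.star_apply, Matrix.of_apply, Matrix.cons_val', Matrix.cons_val_zero,
    Matrix.cons_val_one, Matrix.cons_val_fin_one] at e1 e2
  have e3 : g 1 0 = -star (g 0 1) := by rw [← star_star (g 1 0), e2, star_neg]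
  have hq : g = qm (g 0 0) (g 0 1) := by
    ext i j; fin_cases i <;> fin_cases j <;> simp [qm, e3, ← e1]
  refine ⟨g 0 0, g 0 1, ?_, hq⟩
  rw [Matrix.det_fin_two, e3, ← e1] at h2
  have : ((Complex.normSq (g 0 0) + Complex.normSq (g 0 1) : ℝ) : ℂ) = 1 := by
    rw [← h2, Complex.ofReal_add, ← mul_star_self, ← mul_star_self]; ring
  exact_mod_cast this

theorem conjTranspose_mul_self_of_mem {g : Mat2}
    (hg : g ∈ Matrix.specialUnitaryGroup (Fin 2) ℂ) : gᴴ * g = 1 :=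
  Matrix.mem_unitaryGroup_iff'.1 (Matrix.mem_specialUnitaryGroup_iff.1 hg).1

theorem cov_mem_su2 (z : ℂ) (w : ℝ) : cov z w ∈ su2 := by
  constructor
  · rw [cov, conjTranspose_qm]
    ext i j; fin_cases i <;> fin_cases j <;> simp [qm, neg_div]
  · simp [cov, qm, Matrix.trace_fin_two, neg_div]

theorem eq_cov_of_mem_su2 {A : Mat2} (hA : A ∈ su2) : ∃ z w, A = cov z w := by
  obtain ⟨h1, h2⟩ := hA
  rw [Matrix.trace_fin_two] at h2
  have e1 := congrFun (congrFun h1 0) 0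
  have e2 := congrFun (congrFun h1 1) 0
  simp only [Matrix.conjTranspose_apply, Matrix.neg_apply] at e1 e2
  have hre : (A 0 0).re = 0 := by
    have := congrArg Complex.re e1
    simp only [RCLike.star_def, Complex.conj_re, Complex.neg_re] at this
    linarith
  refine ⟨2 * A 0 1, 2 * (A 0 0).im, ?_⟩
  have h00 : A 0 0 = Complex.I * (A 0 0).im := by
    apply Complex.ext <;> simp [hre]
  have h11 : A 1 1 = -(Complex.I * (A 0 0).im) := by rw [← h00]; linear_combination h2
  have h10 : A 1 0 = -star (A 0 1) := by rw [e2, neg_neg]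
  ext i j; fin_cases i <;> fin_cases j <;>
    simp [cov, qm, h10, h11, mul_div_assoc]
  rw [h00]; simp

theorem mem_cotangentSpace {g P : Mat2} : P ∈ cotangentSpace g ↔ ∃ z w, P = g * cov z w := by
  constructor
  · rintro ⟨A, hA, rfl⟩
    obtain ⟨z, w, rfl⟩ := eq_cov_of_mem_su2 hA
    exact ⟨z, w, rfl⟩
  · rintro ⟨z, w, rfl⟩
    exact ⟨_, cov_mem_su2 z w, rfl⟩

theorem ip_mul_left {g : Mat2} (hg : g ∈ Matrix.specialUnitaryGroup (Fin 2) ℂ) (A B : Mat2) :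
    ip (g * A) (g * B) = ip A B := ip_left_invariant ⟨g, hg⟩ A B

theorem ip_cov (z z' : ℂ) (w w' : ℝ) :
    ip (cov z w) (cov z' w') = z.re * z'.re + z.im * z'.im + w * w' := by
  simp only [ip, cov, conjTranspose_qm, qm_mul]
  simp [qm, Matrix.trace_fin_two]
  ring

theorem X1_eq_cov : X1 = cov 1 0 := by
  ext i j; fin_cases i <;> fin_cases j <;> simp [X1, cov, qm]

theorem X2_eq_cov : X2 = cov Complex.I 0 := by
  ext i j; fin_cases i <;> fin_cases j <;> simp [X2, cov, qm] <;> ring_nf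

theorem cov_zero : cov 0 0 = 0 := by
  ext i j; fin_cases i <;> fin_cases j <;> simp [cov, qm]

theorem smul_X1_add_smul_X2 (z : ℂ) : z.re • X1 + z.im • X2 = cov z 0 := by
  rw [X1_eq_cov, X2_eq_cov]
  ext i j; fin_cases i <;> fin_cases j <;> simp [cov, qm] <;> apply Complex.ext <;> simp <;> ring

theorem ip_cov_X1 (z : ℂ) (w : ℝ) : ip (cov z w) X1 = z.re := by rw [X1_eq_cov, ip_cov]; simp

theorem ip_cov_X2 (z : ℂ) (w : ℝ) : ip (cov z w) X2 = z.im := by rw [X2_eq_cov, ip_cov]; simp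

theorem hamiltonian_mul_cov {g : Mat2} (hg : g ∈ Matrix.specialUnitaryGroup (Fin 2) ℂ) (z : ℂ)
    (w : ℝ) : hamiltonian (g, g * cov z w) = Complex.normSq z / 2 := by
  simp only [hamiltonian, ip_mul_left hg, ip_cov_X1, ip_cov_X2, Complex.normSq_apply]
  ring

/-! ### Calculus of matrix-valued curves -/

theorem isBoundedBilinearMap_matMul :
    IsBoundedBilinearMap ℝ (fun p : Mat2 × Mat2 => p.1 * p.2) where
  add_left := Matrix.add_mul
  smul_left := Matrix.smul_mul
  add_right := Matrix.mul_add
  smul_right c A B := Matrix.mul_smul A c B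
  bound := by
    refine ⟨2, two_pos, fun A B => (Matrix.norm_le_iff (by positivity)).2 fun i j => ?_⟩
    rw [Matrix.mul_apply, Fin.sum_univ_two]
    refine (norm_add_le _ _).trans ?_
    rw [norm_mul, norm_mul, mul_assoc, two_mul]
    gcongr <;> exact Matrix.norm_entry_le_entrywise_sup_norm _

/-- Conjugate transposition as a continuous real linear map. -/
def starCLM : Mat2 →L[ℝ] Mat2 :=
  LinearMap.toContinuousLinearMap
    { toFun := fun A => Aᴴ
      map_add' := Matrix.conjTranspose_add
      map_smul' := fun c A => by simp [Matrix.conjTranspose_smul] }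

/-- The functional `A ↦ 2 Re tr A`. -/
def trCLM : Mat2 →L[ℝ] ℝ :=
  LinearMap.toContinuousLinearMap
    { toFun := fun A => 2 * A.trace.re
      map_add' := fun A B => by simp [Matrix.trace_add]; ring
      map_smul' := fun c A => by simp [Matrix.trace_smul]; ring }

theorem hasDerivAt_matMul {f g : ℝ → Mat2} {f' g' : Mat2} {t : ℝ} (hf : HasDerivAt f f' t)
    (hg : HasDerivAt g g' t) :
    HasDerivAt (fun s => f s * g s) (f' * g t + f t * g') t := by
  rw [add_comm]
  exact (isBoundedBilinearMap_matMul.hasFDerivAt (f t, g t)).comp_hasDerivAt t (hf.prodMk hg)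

theorem hasDerivAt_conjTranspose {f : ℝ → Mat2} {f' : Mat2} {t : ℝ} (hf : HasDerivAt f f' t) :
    HasDerivAt (fun s => (f s)ᴴ) f'ᴴ t := starCLM.hasFDerivAt.comp_hasDerivAt t hf

theorem hasDerivAt_ip {f g : ℝ → Mat2} {f' g' : Mat2} {t : ℝ} (hf : HasDerivAt f f' t)
    (hg : HasDerivAt g g' t) :
    HasDerivAt (fun s => ip (f s) (g s)) (ip f' (g t) + ip (f t) g') t := by
  have h : ip f' (g t) + ip (f t) g' = trCLM (f'ᴴ * g t + (f t)ᴴ * g') :=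
    (map_add trCLM (f'ᴴ * g t) ((f t)ᴴ * g')).symm
  rw [h]
  exact trCLM.hasFDerivAt.comp_hasDerivAt t (hasDerivAt_matMul (hasDerivAt_conjTranspose hf) hg)

theorem hasDerivAt_qm {a b : ℝ → ℂ} {a' b' : ℂ} {t : ℝ} (ha : HasDerivAt a a' t)
    (hb : HasDerivAt b b' t) : HasDerivAt (fun s => qm (a s) (b s)) (qm a' b') t :=
  (LinearMap.toContinuousLinearMap qmL).hasFDerivAt.comp_hasDerivAt t (ha.prodMk hb)

theorem contDiff_matMul {E : Type*} [NormedAddCommGroup E] [NormedSpace ℝ E] {f g : E → Mat2}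
    {n : WithTop ℕ∞} (hf : ContDiff ℝ n f) (hg : ContDiff ℝ n g) :
    ContDiff ℝ n (fun s => f s * g s) :=
  isBoundedBilinearMap_matMul.contDiff.comp (hf.prodMk hg)

theorem contDiff_ip {E : Type*} [NormedAddCommGroup E] [NormedSpace ℝ E] {f g : E → Mat2}
    {n : WithTop ℕ∞} (hf : ContDiff ℝ n f) (hg : ContDiff ℝ n g) :
    ContDiff ℝ n (fun s => ip (f s) (g s)) :=
  trCLM.contDiff.comp (contDiff_matMul (starCLM.contDiff.comp hf) hg)

theorem derivative_mem_submodule {S : Submodule ℝ Mat2} {c : ℝ → Mat2} {V : Mat2} {t : ℝ}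
    (hc : ∀ s, c s ∈ S) (h : HasDerivAt c V t) : V ∈ S := by
  refine S.closed_of_finiteDimensional.mem_of_tendsto h.tendsto_slope
    (Eventually.of_forall fun s => ?_)
  rw [slope_def_module]
  exact S.smul_mem _ (S.sub_mem (hc _) (hc _))

/-! ### The Hamiltonian vector field and its integral curves -/

/-- The sub-Riemannian Hamiltonian vector field, extended to `M₂(ℂ) × M₂(ℂ)`. -/
def hamField (x : Mat2 × Mat2) : Mat2 × Mat2 :=
  (x.1 * (ip x.2 (x.1 * X1) • X1 + ip x.2 (x.1 * X2) • X2),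
    x.2 * (ip x.2 (x.1 * X1) • X1 + ip x.2 (x.1 * X2) • X2))

theorem hamField_mul_cov {g : Mat2} (hg : g ∈ Matrix.specialUnitaryGroup (Fin 2) ℂ) (z : ℂ)
    (w : ℝ) : hamField (g, g * cov z w) = (g * cov z 0, g * cov z w * cov z 0) := by
  simp only [hamField, ip_mul_left hg, ip_cov_X1, ip_cov_X2, smul_X1_add_smul_X2]

theorem contDiff_hamField : ContDiff ℝ 1 hamField := by
  have h1 : ContDiff ℝ 1 (fun x : Mat2 × Mat2 =>
      ip x.2 (x.1 * X1) • X1 + ip x.2 (x.1 * X2) • X2) :=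
    ((contDiff_ip contDiff_snd (contDiff_matMul contDiff_fst contDiff_const)).smul
      contDiff_const).add
    ((contDiff_ip contDiff_snd (contDiff_matMul contDiff_fst contDiff_const)).smul contDiff_const)
  exact (contDiff_matMul contDiff_fst h1).prodMk (contDiff_matMul contDiff_snd h1)

/-! ### Explicit extremals -/

/-- First entry of the exponential of the covector `(z, w)`, in terms of its length `r`. -/
def flowA (r w t : ℝ) : ℂ :=
  ((Real.cos (r * t / 2) : ℝ) + Complex.I * (w / r) * (Real.sin (r * t / 2) : ℝ)) *
    Complex.exp (-(w * t / 2 : ℝ) * Complex.I)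

/-- Second entry of the exponential of the covector `(z, w)`, in terms of its length `r`. -/
def flowB (r : ℝ) (z : ℂ) (w t : ℝ) : ℂ :=
  z * ((Real.sin (r * t / 2) : ℝ) / r) * Complex.exp ((w * t / 2 : ℝ) * Complex.I)

/-- The length of the covector with coordinates `(z, w)`. -/
def len (z : ℂ) (w : ℝ) : ℝ := Real.sqrt (Complex.normSq z + w ^ 2)

theorem len_sq (z : ℂ) (w : ℝ) : len z w ^ 2 = Complex.normSq z + w ^ 2 :=
  Real.sq_sqrt (add_nonneg (Complex.normSq_nonneg z) (sq_nonneg w))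

theorem len_nonneg (z : ℂ) (w : ℝ) : 0 ≤ len z w := Real.sqrt_nonneg _

theorem eq_zero_of_len {z : ℂ} {w : ℝ} (h : len z w = 0) : z = 0 ∧ w = 0 := by
  have := len_sq z w
  rw [h] at this
  have h1 := Complex.normSq_nonneg z
  have h2 := sq_nonneg w
  exact ⟨Complex.normSq_eq_zero.1 (by linarith), pow_eq_zero_iff two_ne_zero |>.1 (by linarith)⟩

theorem normSq_exp_ofReal_mul_I (x : ℝ) : Complex.normSq (Complex.exp (x * Complex.I)) = 1 := by
  rw [Complex.normSq_eq_norm_sq, Complex.norm_exp_ofReal_mul_I, one_pow]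

theorem normSq_flow {r : ℝ} (hr : r ≠ 0) {z : ℂ} {w : ℝ} (h : r ^ 2 = Complex.normSq z + w ^ 2)
    (t : ℝ) : Complex.normSq (flowA r w t) + Complex.normSq (flowB r z w t) = 1 := by
  rw [flowA, flowB, Complex.normSq_mul, Complex.normSq_mul, Complex.normSq_mul,
    normSq_exp_ofReal_mul_I, ← Complex.ofReal_neg, normSq_exp_ofReal_mul_I]
  have h1 : ((Real.cos (r * t / 2) : ℝ) : ℂ) + Complex.I * (w / r) * (Real.sin (r * t / 2) : ℝ) =
      (Real.cos (r * t / 2) : ℝ) + (w / r * Real.sin (r * t / 2) : ℝ) * Complex.I := by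
    push_cast; ring
  rw [h1, Complex.normSq_add_mul_I, ← Complex.ofReal_div, Complex.normSq_ofReal]
  have h2 := Real.sin_sq_add_cos_sq (r * t / 2)
  have h3 : Complex.normSq z = r ^ 2 - w ^ 2 := by linarith
  rw [h3]
  field_simp
  linear_combination r ^ 2 * h2

/-- Together with `hasDerivAt_flowB`, this is the first row of `G' = G * cov ζ 0` with `ζ t = z *
exp (i w t)`. The relation `|z|² = r² - w²` enters only here. -/
theorem hasDerivAt_flowA {r : ℝ} (hr : r ≠ 0) {z : ℂ} {w : ℝ}
    (h : r ^ 2 = Complex.normSq z + w ^ 2) (t : ℝ) :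
    HasDerivAt (flowA r w) (-(flowB r z w t * star (z * Complex.exp ((w * t : ℝ) * Complex.I) / 2)))
      t := by
  have hc : HasDerivAt (fun t => ((Real.cos (r * t / 2) : ℝ) : ℂ))
      ((-Real.sin (r * t / 2) * (r / 2) : ℝ) : ℂ) t :=
    (((hasDerivAt_id t).const_mul r |>.div_const 2).cos.congr_deriv (by simp)).ofReal_comp
  have hs : HasDerivAt (fun t => ((Real.sin (r * t / 2) : ℝ) : ℂ))
      ((Real.cos (r * t / 2) * (r / 2) : ℝ) : ℂ) t :=
    (((hasDerivAt_id t).const_mul r |>.div_const 2).sin.congr_deriv (by simp)).ofReal_comp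
  have he : HasDerivAt (fun t => Complex.exp (-(w * t / 2 : ℝ) * Complex.I))
      (Complex.exp (-(w * t / 2 : ℝ) * Complex.I) * (-(w / 2 : ℝ) * Complex.I)) t := by
    have : HasDerivAt (fun t : ℝ => ((w * t / 2 : ℝ) : ℂ)) ((w / 2 : ℝ) : ℂ) t :=
      (((hasDerivAt_id t).const_mul w |>.div_const 2).congr_deriv (by simp)).ofReal_comp
    exact (this.neg.mul_const Complex.I).cexp
  refine ((hc.add (hs.const_mul (Complex.I * (w / r)))).mul he).congr_deriv ?_
  have hstar : star (z * Complex.exp ((w * t : ℝ) * Complex.I) / 2) =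
      star z * Complex.exp (-(w * t / 2 : ℝ) * Complex.I) *
        Complex.exp (-(w * t / 2 : ℝ) * Complex.I) / 2 := by
    rw [mul_assoc (star z), ← Complex.exp_add]
    simp [← Complex.exp_conj]
    exact Or.inl (by congr 1; ring)
  have hinv : Complex.exp ((w * t / 2 : ℝ) * Complex.I) *
      Complex.exp (-(w * t / 2 : ℝ) * Complex.I) = 1 := by
    rw [← Complex.exp_add]; simp
  have hz : z * star z = r ^ 2 - w ^ 2 := by
    rw [mul_star_self]
    have : Complex.normSq z = r ^ 2 - w ^ 2 := by linarith
    rw [this]; push_cast; ring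
  rw [hstar, flowB]
  simp only [Pi.add_apply]
  have hr' : (r : ℂ) ≠ 0 := by exact_mod_cast hr
  set S : ℂ := ((Real.sin (r * t / 2) : ℝ) : ℂ)
  set e := Complex.exp (-(w * t / 2 : ℝ) * Complex.I)
  set e' := Complex.exp ((w * t / 2 : ℝ) * Complex.I)
  have : z * (S / r) * e' * (star z * e * e / 2) = (r ^ 2 - w ^ 2) * S / r * e / 2 := by
    rw [← hz]; linear_combination z * (S / r) * star z * e / 2 * hinv
  rw [this]
  simp only [Complex.ofReal_neg, Complex.ofReal_mul, Complex.ofReal_div, Complex.ofReal_ofNat,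
    show ((Real.sin (r * t / 2) : ℝ) : ℂ) = S from rfl]
  field_simp
  ring_nf
  simp only [Complex.I_sq]
  ring

theorem hasDerivAt_flowB {r : ℝ} (hr : r ≠ 0) (z : ℂ) (w : ℝ) (t : ℝ) :
    HasDerivAt (flowB r z w) (flowA r w t * (z * Complex.exp ((w * t : ℝ) * Complex.I) / 2)) t := by
  have hs : HasDerivAt (fun t => ((Real.sin (r * t / 2) : ℝ) : ℂ))
      ((Real.cos (r * t / 2) * (r / 2) : ℝ) : ℂ) t :=
    (((hasDerivAt_id t).const_mul r |>.div_const 2).sin.congr_deriv (by simp)).ofReal_comp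
  have he : HasDerivAt (fun t => Complex.exp ((w * t / 2 : ℝ) * Complex.I))
      (Complex.exp ((w * t / 2 : ℝ) * Complex.I) * ((w / 2 : ℝ) * Complex.I)) t := by
    have : HasDerivAt (fun t : ℝ => ((w * t / 2 : ℝ) : ℂ)) ((w / 2 : ℝ) : ℂ) t :=
      (((hasDerivAt_id t).const_mul w |>.div_const 2).congr_deriv (by simp)).ofReal_comp
    exact (this.mul_const Complex.I).cexp
  refine (((hs.div_const (r : ℂ)).const_mul z).mul he).congr_deriv ?_
  have hexp : Complex.exp ((w * t : ℝ) * Complex.I) = Complex.exp ((w * t / 2 : ℝ) * Complex.I) *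
      Complex.exp ((w * t / 2 : ℝ) * Complex.I) := by
    rw [← Complex.exp_add]; congr 1; push_cast; ring
  have hinv : Complex.exp ((w * t / 2 : ℝ) * Complex.I) *
      Complex.exp (-(w * t / 2 : ℝ) * Complex.I) = 1 := by
    rw [← Complex.exp_add]; simp
  rw [hexp, flowA]
  have hr' : (r : ℂ) ≠ 0 := by exact_mod_cast hr
  set S : ℂ := ((Real.sin (r * t / 2) : ℝ) : ℂ)
  set e := Complex.exp (-(w * t / 2 : ℝ) * Complex.I)
  set e' := Complex.exp ((w * t / 2 : ℝ) * Complex.I)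
  push_cast
  have : e * (z * (e' * e') / 2) = z * e' / 2 := by linear_combination z * e' / 2 * hinv
  rw [mul_assoc _ e, this]
  field_simp

/-- The integral curve of the Hamiltonian vector field through a covector, with its explicit
base point at time `1`. -/
theorem exists_integralCurve {g : Mat2} (hg : g ∈ Matrix.specialUnitaryGroup (Fin 2) ℂ) (z : ℂ)
    (w : ℝ) : ∃ x : ℝ → Mat2 × Mat2, x 0 = (g, g * cov z w) ∧ (∀ t, x t ∈ cotangentBundle) ∧
      (∀ t, HasDerivAt x (hamField (x t)) t) ∧
      (x 1).1 = g * qm (flowA (len z w) w 1) (flowB (len z w) z w 1) := by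
  -- At the zero covector the curve is constant; since division by zero gives `0`, the formulas
  -- still return `1` and `0`.
  by_cases hr : len z w = 0
  · obtain ⟨rfl, rfl⟩ := eq_zero_of_len hr
    refine ⟨fun _ => (g, g * cov 0 0), rfl, fun _ => ⟨hg, mem_cotangentSpace.2 ⟨0, 0, rfl⟩⟩,
      fun t => ?_, ?_⟩
    · rw [hamField_mul_cov hg, cov_zero, mul_zero, mul_zero]
      exact hasDerivAt_const _ _
    · rw [hr]
      simp [flowA, flowB, qm_one_zero]
  set r := len z w
  have hsq : r ^ 2 = Complex.normSq z + w ^ 2 := len_sq z w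
  let G : ℝ → Mat2 := fun t => g * qm (flowA r w t) (flowB r z w t)
  -- The horizontal momentum turns at the constant rate `w`, and `w` itself is conserved.
  let ζ : ℝ → ℂ := fun t => z * Complex.exp ((w * t : ℝ) * Complex.I)
  have hG : ∀ t, G t ∈ Matrix.specialUnitaryGroup (Fin 2) ℂ := fun t =>
    mul_mem hg (qm_mem (normSq_flow hr hsq t))
  have hζ : ∀ t, HasDerivAt ζ (w * Complex.I * ζ t) t := by
    intro t
    have : HasDerivAt (fun t : ℝ => ((w * t : ℝ) : ℂ)) ((w : ℝ) : ℂ) t :=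
      (((hasDerivAt_id t).const_mul w).congr_deriv (by simp)).ofReal_comp
    refine ((this.mul_const Complex.I).cexp.const_mul z).congr_deriv ?_
    simp only [ζ]; ring
  have hGd : ∀ t, HasDerivAt G (G t * cov (ζ t) 0) t := by
    intro t
    have h1 := hasDerivAt_matMul (hasDerivAt_const t g)
      (hasDerivAt_qm (hasDerivAt_flowA hr hsq t) (hasDerivAt_flowB hr z w t))
    refine h1.congr_deriv ?_
    rw [zero_mul, zero_add]
    simp only [G]
    rw [mul_assoc, cov, qm_mul]
    simp [ζ]
  refine ⟨fun t => (G t, G t * cov (ζ t) w), ?_, fun t => ⟨hG t, mem_cotangentSpace.2 ⟨_, _, rfl⟩⟩,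
    fun t => ?_, rfl⟩
  · simp [G, ζ, flowA, flowB, qm_one_zero]
  · change HasDerivAt _ (hamField (G t, G t * cov (ζ t) w)) t
    rw [hamField_mul_cov (hG t)]
    refine (hGd t).prodMk ?_
    have h1 := hasDerivAt_matMul (hGd t)
      (hasDerivAt_qm (hasDerivAt_const t (Complex.I * w / 2)) ((hζ t).div_const 2))
    refine h1.congr_deriv ?_
    rw [mul_assoc (G t), mul_assoc (G t), ← mul_add]
    congr 1
    rw [cov, cov, qm_mul, qm_mul]
    ext i j; fin_cases i <;> fin_cases j <;> simp [qm] <;> ring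

/-! ### Existence and uniqueness of the Hamiltonian vector -/

theorem ip_comm (A B : Mat2) : ip A B = ip B A := by
  have h : (Aᴴ * B).trace = star ((Bᴴ * A).trace) := by
    rw [← Matrix.trace_conjTranspose, Matrix.conjTranspose_mul, Matrix.conjTranspose_conjTranspose]
  rw [ip, ip, h]; simp

theorem ip_zero_left (A : Mat2) : ip 0 A = 0 := by simp [ip]

theorem ip_zero_right (A : Mat2) : ip A 0 = 0 := by simp [ip]

theorem ip_add_right (A B C : Mat2) : ip A (B + C) = ip A B + ip A C := by
  simp [ip, Matrix.mul_add, Matrix.trace_add]; ring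

theorem ip_sub_right (A B C : Mat2) : ip A (B - C) = ip A B - ip A C := by
  simp [ip, Matrix.mul_sub, Matrix.trace_sub]; ring

theorem ip_sub_left (A B C : Mat2) : ip (A - B) C = ip A C - ip B C := by
  rw [ip_comm, ip_sub_right, ip_comm C, ip_comm C]

theorem ip_smul_right (A B : Mat2) (c : ℝ) : ip A (c • B) = c * ip A B := by
  simp [ip, Matrix.trace_smul]; ring

theorem eq_zero_of_ip_self {A : Mat2} (hA : A ∈ su2) (h : ip A A = 0) : A = 0 := by
  obtain ⟨z, w, rfl⟩ := eq_cov_of_mem_su2 hA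
  rw [ip_cov] at h
  have hz : z = 0 := by
    apply Complex.ext <;> simp <;> nlinarith [mul_self_nonneg z.re, mul_self_nonneg z.im, mul_self_nonneg w]
  have hw : w = 0 := by nlinarith [mul_self_nonneg z.re, mul_self_nonneg z.im, mul_self_nonneg w]
  rw [hz, hw, cov_zero]

/-- Right multiplication by an antihermitian matrix is skew for `ip`. -/
theorem ip_mul_right_skew {B : Mat2} (hB : Bᴴ = -B) (P V : Mat2) :
    ip P (V * B) = -ip (P * B) V := by
  rw [ip, ip, Matrix.conjTranspose_mul, hB, ← Matrix.mul_assoc, Matrix.trace_mul_comm]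
  simp [Matrix.mul_assoc]

/-- Tangency is witnessed by the explicit integral curve. In `dH (V)`, the terms containing `V.1`
are turned by `ip_mul_right_skew` into minus the pairing of `V.1` with the second component of
`hamField`, as `symplecticForm` requires. -/
theorem isHamiltonianVector_hamField {x : Mat2 × Mat2} (hx : x ∈ cotangentBundle) :
    IsHamiltonianVector x (hamField x) := by
  obtain ⟨g, P⟩ := x
  obtain ⟨hg, hP⟩ := hx
  obtain ⟨z, w, hPz⟩ := mem_cotangentSpace.1 hP
  simp only at hg hPz
  subst hPz
  constructor
  · obtain ⟨c, hc0, hcm, hcd, -⟩ := exists_integralCurve hg z w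
    exact ⟨c, hcm, hc0, by simpa [hc0] using hcd 0⟩
  · rintro c V ⟨-, hc0, hcd⟩
    have h1 : HasDerivAt (fun s => (c s).1) V.1 0 := hcd.fst
    have h2 : HasDerivAt (fun s => (c s).2) V.2 0 := hcd.snd
    have hk : ∀ B : Mat2, HasDerivAt (fun s => ip (c s).2 ((c s).1 * B))
        (ip V.2 (g * B) + ip (g * cov z w) (V.1 * B)) 0 := by
      intro B
      have := hasDerivAt_ip h2 (hasDerivAt_matMul h1 (hasDerivAt_const 0 B))
      simpa [hc0] using this
    refine ((((hk X1).pow 2).add ((hk X2).pow 2)).const_mul (1 / 2)).congr_deriv ?_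
    rw [hamField_mul_cov hg, symplecticForm, ip_comm (g * cov z w * cov z 0)]
    simp only [hc0, ip_mul_left hg, ip_cov_X1, ip_cov_X2]
    have e1 : ip V.2 (g * cov z 0) = z.re * ip V.2 (g * X1) + z.im * ip V.2 (g * X2) := by
      rw [← smul_X1_add_smul_X2, Matrix.mul_add, ip_add_right, Matrix.mul_smul, Matrix.mul_smul,
        ip_smul_right, ip_smul_right]
    have e2 : ip (g * cov z w) (V.1 * cov z 0) =
        z.re * ip (g * cov z w) (V.1 * X1) + z.im * ip (g * cov z w) (V.1 * X2) := by
      rw [← smul_X1_add_smul_X2, Matrix.mul_add, ip_add_right, Matrix.mul_smul, Matrix.mul_smul,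
        ip_smul_right, ip_smul_right]
    rw [ip_mul_right_skew (cov_mem_su2 z 0).1, ip_comm (g * cov z w * cov z 0)] at e2
    rw [e1, sub_eq_add_neg, e2]
    ring

/-- Supplies test curves in every direction of the base. The extremal of `(z, w)` starts with
velocity `cov z 0`; the extra phase `exp (i w s / 2)` on its first entry adds the missing `X₀`
component. -/
theorem exists_curve_unitary {C : Mat2} (hC : C ∈ su2) : ∃ γ : ℝ → Mat2, γ 0 = 1 ∧
    (∀ s, γ s ∈ Matrix.specialUnitaryGroup (Fin 2) ℂ) ∧ HasDerivAt γ C 0 := by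
  obtain ⟨z, w, rfl⟩ := eq_cov_of_mem_su2 hC
  by_cases hr : len z w = 0
  · obtain ⟨rfl, rfl⟩ := eq_zero_of_len hr
    exact ⟨fun _ => 1, rfl, fun _ => one_mem _, by rw [cov_zero]; exact hasDerivAt_const _ _⟩
  set r := len z w
  have hsq : r ^ 2 = Complex.normSq z + w ^ 2 := len_sq z w
  have hr' : (r : ℂ) ≠ 0 := by exact_mod_cast hr
  have he : HasDerivAt (fun s : ℝ => Complex.exp ((w * s / 2 : ℝ) * Complex.I))
      (w / 2 * Complex.I) 0 := by
    have : HasDerivAt (fun t : ℝ => ((w * t / 2 : ℝ) : ℂ)) ((w / 2 : ℝ) : ℂ) 0 :=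
      (((hasDerivAt_id (0 : ℝ)).const_mul w |>.div_const 2).congr_deriv (by simp)).ofReal_comp
    simpa using (this.mul_const Complex.I).cexp
  refine ⟨fun s => qm (flowA r w s * Complex.exp ((w * s / 2 : ℝ) * Complex.I)) (flowB r z w s),
    by simp [flowA, flowB, qm_one_zero], fun s => qm_mem ?_, ?_⟩
  · rw [Complex.normSq_mul, normSq_exp_ofReal_mul_I, mul_one, normSq_flow hr hsq]
  · refine (hasDerivAt_qm ((hasDerivAt_flowA hr hsq 0).mul he)
      (hasDerivAt_flowB hr z w 0)).congr_deriv ?_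
    simp [flowA, flowB, cov]
    congr 1
    ring

/-- Velocities of curves in `T*SU(2)`: both left-trivialized components lie in `𝔰𝔲(2)`. -/
theorem tangent_mem {g A : Mat2} (hg : g ∈ Matrix.specialUnitaryGroup (Fin 2) ℂ)
    {c : ℝ → Mat2 × Mat2} {V : Mat2 × Mat2} (h : IsCurveWithVelocity c (g, g * A) V) :
    gᴴ * V.1 ∈ su2 ∧ V.1ᴴ * (g * A) + gᴴ * V.2 ∈ su2 := by
  obtain ⟨hcm, hc0, hcd⟩ := h
  have h1 : HasDerivAt (fun s => (c s).1) V.1 0 := hcd.fst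
  have h2 : HasDerivAt (fun s => (c s).2) V.2 0 := hcd.snd
  constructor
  -- Being antihermitian does not kill the trace; the quaternionic form does, its diagonal entries
  -- being conjugate to each other.
  · have hq : gᴴ * V.1 ∈ LinearMap.range qmL := by
      refine derivative_mem_submodule (c := fun s => gᴴ * (c s).1) (fun s => ?_)
        ((hasDerivAt_matMul (hasDerivAt_const 0 gᴴ) h1).congr_deriv (by rw [zero_mul, zero_add]))
      obtain ⟨a, b, -, rfl⟩ := exists_qm_of_mem hg
      obtain ⟨a', b', -, h'⟩ := exists_qm_of_mem (hcm s).1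
      rw [h', conjTranspose_qm, qm_mul]
      exact ⟨(_, _), rfl⟩
    have hskew : V.1ᴴ * g + gᴴ * V.1 = 0 := by
      have e1 := hasDerivAt_matMul (hasDerivAt_conjTranspose h1) h1
      have e2 : (fun s => (c s).1ᴴ * (c s).1) = fun _ => (1 : Mat2) :=
        funext fun s => conjTranspose_mul_self_of_mem (hcm s).1
      rw [e2, hc0] at e1
      exact e1.unique (hasDerivAt_const _ _)
    obtain ⟨⟨a, b⟩, hab⟩ := hq
    have hst : (gᴴ * V.1)ᴴ = -(gᴴ * V.1) := by
      rw [Matrix.conjTranspose_mul, Matrix.conjTranspose_conjTranspose]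
      exact eq_neg_of_add_eq_zero_left hskew
    refine ⟨hst, ?_⟩
    have e0 := congrFun (congrFun hst 0) 0
    rw [← hab] at e0 ⊢
    change (qm a b)ᴴ 0 0 = (-qm a b) 0 0 at e0
    change (qm a b).trace = 0
    simp [qm] at e0
    simp [qm, Matrix.trace_fin_two, e0]
  · refine derivative_mem_submodule (c := fun s => (c s).1ᴴ * (c s).2) (t := 0) (fun s => ?_) ?_
    · obtain ⟨z, w, h'⟩ := mem_cotangentSpace.1 (hcm s).2
      rw [h', ← mul_assoc, conjTranspose_mul_self_of_mem (hcm s).1, one_mul]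
      exact cov_mem_su2 z w
    · have := hasDerivAt_matMul (hasDerivAt_conjTranspose h1) h2
      rw [hc0] at this
      exact this

/-- Nondegeneracy of `σ` on `T*SU(2)`. Testing the difference against a vertical direction forces
equal base components; only then is the difference of the fibre components a left translate of an
element of `su2`, which a test along the base annihilates. -/
theorem IsHamiltonianVector.eq_hamField {x W : Mat2 × Mat2} (hx : x ∈ cotangentBundle)
    (hW : IsHamiltonianVector x W) : W = hamField x := by
  obtain ⟨g, P⟩ := x
  obtain ⟨hg, hP⟩ := hx
  obtain ⟨z, w, hPz⟩ := mem_cotangentSpace.1 hP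
  simp only at hg hPz
  subst hPz
  have hF := isHamiltonianVector_hamField (x := (g, g * cov z w))
    ⟨hg, mem_cotangentSpace.2 ⟨z, w, rfl⟩⟩
  obtain ⟨⟨c, hc⟩, hWσ⟩ := hW
  obtain ⟨⟨c', hc'⟩, hFσ⟩ := hF
  have t1 := tangent_mem hg hc
  have t2 := tangent_mem hg hc'
  set F := hamField (g, g * cov z w)
  have hσ : ∀ c V, IsCurveWithVelocity c (g, g * cov z w) V →
      ip V.2 (W.1 - F.1) - ip (W.2 - F.2) V.1 = 0 := by
    intro c V hcV
    have := (hWσ c V hcV).unique (hFσ c V hcV)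
    simp only [symplecticForm] at this
    rw [ip_sub_right, ip_sub_left]
    linarith
  have hgg : ∀ M : Mat2, g * (gᴴ * M) = M := fun M => by
    rw [← mul_assoc]
    have : g * gᴴ = 1 :=
      Matrix.mem_unitaryGroup_iff.1 (Matrix.mem_specialUnitaryGroup_iff.1 hg).1
    rw [this, one_mul]
  have hB : gᴴ * (W.1 - F.1) ∈ su2 := by rw [mul_sub]; exact su2.sub_mem t1.1 t2.1
  have hB0 : W.1 - F.1 = 0 := by
    set B := gᴴ * (W.1 - F.1)
    have hBg : W.1 - F.1 = g * B := (hgg _).symm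
    -- The test direction is the difference itself, so that the pairing becomes `ip B B`. The same
    -- choice is made for `C` below.
    have := hσ (fun s => (g, g * (cov z w + s • B))) (0, g * B) ⟨fun s => ⟨hg, ?_⟩, by simp, ?_⟩
    · rw [hBg] at this
      simp only [ip_zero_right, sub_zero, ip_mul_left hg] at this
      rw [hBg, eq_zero_of_ip_self hB this, mul_zero]
    · exact ⟨_, su2.add_mem (cov_mem_su2 z w) (su2.smul_mem _ hB), rfl⟩
    · refine (hasDerivAt_const _ _).prodMk ?_
      have := hasDerivAt_matMul (hasDerivAt_const (0 : ℝ) g)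
        (((hasDerivAt_id (0 : ℝ)).smul_const B).const_add (cov z w))
      refine this.congr_deriv ?_
      rw [zero_mul, zero_add, one_smul]
  have h1 : W.1 = F.1 := sub_eq_zero.1 hB0
  have hC : gᴴ * (W.2 - F.2) ∈ su2 := by
    have := su2.sub_mem t1.2 t2.2
    rw [h1, add_sub_add_left_eq_sub, ← mul_sub] at this
    exact this
  have hC0 : W.2 - F.2 = 0 := by
    set C := gᴴ * (W.2 - F.2)
    have hCg : W.2 - F.2 = g * C := (hgg _).symm
    obtain ⟨γ, hγ0, hγm, hγd⟩ := exists_curve_unitary hC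
    have hd := hasDerivAt_matMul (hasDerivAt_const (0 : ℝ) g) hγd
    rw [zero_mul, zero_add] at hd
    have := hσ (fun s => (g * γ s, g * γ s * cov z w)) (g * C, g * C * cov z w)
      ⟨fun s => ⟨mul_mem hg (hγm s), mem_cotangentSpace.2 ⟨_, _, rfl⟩⟩, by simp [hγ0],
        hd.prodMk ?_⟩
    · rw [hB0, hCg] at this
      simp only [ip_zero_right, zero_sub, ip_mul_left hg, neg_eq_zero] at this
      rw [hCg, eq_zero_of_ip_self hC this, mul_zero]
    · have := hasDerivAt_matMul hd (hasDerivAt_const (0 : ℝ) (cov z w))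
      rwa [mul_zero, add_zero] at this
  exact Prod.ext h1 (sub_eq_zero.1 hC0)

/-! ### The exponential map -/

/-- Both curves solve `x' = hamField x`, and `hamField` is Lipschitz on the compact union of their
images, so uniqueness for ODEs applies. -/
theorem IsNormalExtremal.eqOn {x y : ℝ → Mat2 × Mat2} (hx : IsNormalExtremal x)
    (hy : IsNormalExtremal y) (h : x 0 = y 0) : EqOn x y (Icc 0 1) := by
  have key : ∀ x : ℝ → Mat2 × Mat2, IsNormalExtremal x → ∀ t ∈ Icc (0 : ℝ) 1,
      HasDerivWithinAt x (hamField (x t)) (Icc 0 1) t := by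
    intro x hx t ht
    obtain ⟨hm, W, hW, hd⟩ := hx t ht
    rwa [hW.eq_hamField hm] at hd
  have hcx : ContinuousOn x (Icc 0 1) := fun t ht => (key x hx t ht).continuousWithinAt
  have hcy : ContinuousOn y (Icc 0 1) := fun t ht => (key y hy t ht).continuousWithinAt
  have hK : IsCompact (x '' Icc 0 1 ∪ y '' Icc 0 1) :=
    (isCompact_Icc.image_of_continuousOn hcx).union (isCompact_Icc.image_of_continuousOn hcy)
  obtain ⟨K, hLip⟩ := (contDiff_hamField.locallyLipschitz.locallyLipschitzOn
    (s := x '' Icc 0 1 ∪ y '' Icc 0 1)).exists_lipschitzOnWith_of_compact hK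
  have hIci : ∀ x : ℝ → Mat2 × Mat2, IsNormalExtremal x → ∀ t ∈ Ico (0 : ℝ) 1,
      HasDerivWithinAt x (hamField (x t)) (Ici t) t := fun x hx t ht =>
    (key x hx t (Ico_subset_Icc_self ht)).mono_of_mem_nhdsWithin
      (mem_of_superset (Icc_mem_nhdsGE ht.2) (Icc_subset_Icc_left ht.1))
  exact ODE_solution_unique_of_mem_Icc_right (v := fun _ => hamField)
    (s := fun _ => x '' Icc 0 1 ∪ y '' Icc 0 1) (fun _ _ => hLip) hcx (hIci x hx)
    (fun t ht => Or.inl ⟨t, Ico_subset_Icc_self ht, rfl⟩) hcy (hIci y hy)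
    (fun t ht => Or.inr ⟨t, Ico_subset_Icc_self ht, rfl⟩) h

theorem exists_normalExtremal {g : Mat2} (hg : g ∈ Matrix.specialUnitaryGroup (Fin 2) ℂ) (z : ℂ)
    (w : ℝ) : ∃ x, IsNormalExtremal x ∧ x 0 = (g, g * cov z w) ∧
      (x 1).1 = g * qm (flowA (len z w) w 1) (flowB (len z w) z w 1) := by
  obtain ⟨x, hx0, hxm, hxd, hx1⟩ := exists_integralCurve hg z w
  exact ⟨x, fun t _ => ⟨hxm t, _, isHamiltonianVector_hamField (hxm t),
    (hxd t).hasDerivWithinAt⟩, hx0, hx1⟩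

theorem expDomain_eq_univ (q : SU2) : expDomain q = univ := by
  refine eq_univ_of_forall fun p => ?_
  obtain ⟨z, w, hp⟩ := mem_cotangentSpace.1 p.2
  obtain ⟨x, hx, hx0, -⟩ := exists_normalExtremal q.2 z w
  exact ⟨x, hx, by rw [hx0, hp]⟩

theorem srExp_eq (q : SU2) (p : cotangentSpace q) {z : ℂ} {w : ℝ}
    (hp : (p : Mat2) = (q : Mat2) * cov z w) :
    (srExp q p : Mat2) = q * qm (flowA (len z w) w 1) (flowB (len z w) z w 1) := by
  have hdom : p ∈ expDomain q := by rw [expDomain_eq_univ]; trivial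
  obtain ⟨x, hx, hx0, hx1⟩ := exists_normalExtremal q.2 z w
  rw [srExp, dif_pos hdom]
  have h0 : hdom.choose 0 = x 0 := by rw [hdom.choose_spec.2, hx0, hp]
  have := (hdom.choose_spec.1.eqOn hx h0) (right_mem_Icc.2 zero_le_one)
  change (hdom.choose 1).1 = _
  rw [this, hx1]

/-! ### Linear coordinates on the cotangent space -/

/-- `cov` as a real linear map. -/
def covLinear : ℂ × ℝ →ₗ[ℝ] Mat2 where
  toFun x := cov x.1 x.2
  map_add' x y := by
    ext i j; fin_cases i <;> fin_cases j <;> simp [cov, qm] <;> ring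
  map_smul' c x := by
    ext i j; fin_cases i <;> fin_cases j <;> simp [cov, qm] <;> ring

/-- The coordinates `(u + i v, w)` on the cotangent space at `q`. -/
def covEquiv (q : SU2) : cotangentSpace q ≃L[ℝ] ℂ × ℝ :=
  (LinearEquiv.ofBijective
    (((LinearMap.mulLeft ℝ (q : Mat2)).comp covLinear).codRestrict (cotangentSpace q)
      fun x => mem_cotangentSpace.2 ⟨x.1, x.2, rfl⟩)
    ⟨by
      rw [← LinearMap.ker_eq_bot, LinearMap.ker_eq_bot']
      intro x hx
      have h1 : (q : Mat2) * cov x.1 x.2 = 0 := congrArg Subtype.val hx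
      have h2 : ip (cov x.1 x.2) (cov x.1 x.2) = 0 := by
        rw [← ip_mul_left q.2, h1, ip_zero_left]
      rw [ip_cov] at h2
      have h3 : len x.1 x.2 = 0 := by
        rw [len, Complex.normSq_apply, sq, h2, Real.sqrt_zero]
      exact Prod.ext (eq_zero_of_len h3).1 (eq_zero_of_len h3).2,
    fun p => by
      obtain ⟨z, w, hp⟩ := mem_cotangentSpace.1 p.2
      exact ⟨(z, w), Subtype.ext hp.symm⟩⟩).symm.toContinuousLinearEquiv

theorem coe_covEquiv_symm (q : SU2) (x : ℂ × ℝ) :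
    ((covEquiv q).symm x : Mat2) = q * cov x.1 x.2 := rfl

theorem coe_eq_mul_cov (q : SU2) (p : cotangentSpace q) :
    (p : Mat2) = q * cov (covEquiv q p).1 (covEquiv q p).2 := by
  rw [← coe_covEquiv_symm, ContinuousLinearEquiv.symm_apply_apply]

theorem covNorm_eq_len (q : SU2) (p : cotangentSpace q) :
    covNorm q p = len (covEquiv q p).1 (covEquiv q p).2 := by
  rw [covNorm, coe_eq_mul_cov, ip_mul_left q.2, ip_cov, len, Complex.normSq_apply, sq]

theorem hamiltonian_ne_zero_iff (q : SU2) (p : cotangentSpace q) :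
    hamiltonian ((q : Mat2), (p : Mat2)) ≠ 0 ↔ (covEquiv q p).1 ≠ 0 := by
  rw [coe_eq_mul_cov, hamiltonian_mul_cov q.2]
  simp

/-- The exponential map in coordinates: the first row of the group element `q⁻¹ exp_q(p)`. -/
def expRow (x : ℂ × ℝ) : ℂ × ℂ :=
  (flowA (len x.1 x.2) x.2 1, flowB (len x.1 x.2) x.1 x.2 1)

theorem coe_srExp (q : SU2) (p : cotangentSpace q) :
    (srExp q p : Mat2) = q * qm (expRow (covEquiv q p)).1 (expRow (covEquiv q p)).2 :=
  srExp_eq q p (coe_eq_mul_cov q p)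

/-! ### Charts of `SU(2)` -/

theorem normSq_star (c : ℂ) : Complex.normSq (star c) = Complex.normSq c := Complex.normSq_conj c

/-- Three of the four real coordinates of the unit vector `(c a, d b)` of `ℂ²`. -/
def rowCoord (c d : ℂ) (x : ℂ × ℂ) : ℝ × ℝ × ℝ := ((d * x.2).re, (c * x.1).im, (d * x.2).im)

/-- First row of `q⁻¹ g`. -/
def row (q : Mat2) (g : Mat2) : ℂ × ℂ := ((qᴴ * g) 0 0, (qᴴ * g) 0 1)

theorem row_mul_qm {q : Mat2} (hq : q ∈ Matrix.specialUnitaryGroup (Fin 2) ℂ) (a b : ℂ) :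
    row q (q * qm a b) = (a, b) := by
  rw [row, ← mul_assoc, conjTranspose_mul_self_of_mem hq, one_mul]
  simp [qm]

theorem exists_row {q g : Mat2} (hq : q ∈ Matrix.specialUnitaryGroup (Fin 2) ℂ)
    (hg : g ∈ Matrix.specialUnitaryGroup (Fin 2) ℂ) :
    Complex.normSq (row q g).1 + Complex.normSq (row q g).2 = 1 ∧
      g = q * qm (row q g).1 (row q g).2 := by
  have h1 : qᴴ * g ∈ Matrix.specialUnitaryGroup (Fin 2) ℂ := by
    obtain ⟨a, b, hab, rfl⟩ := exists_qm_of_mem hq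
    rw [conjTranspose_qm]
    refine mul_mem (qm_mem ?_) hg
    rw [normSq_star, Complex.normSq_neg, hab]
  obtain ⟨a, b, hab, h⟩ := exists_qm_of_mem h1
  have h2 : g = q * qm a b := by
    rw [← h, ← mul_assoc]
    have : q * qᴴ = 1 :=
      Matrix.mem_unitaryGroup_iff.1 (Matrix.mem_specialUnitaryGroup_iff.1 hq).1
    rw [this, one_mul]
  have h3 : row q g = (a, b) := by rw [h2, row_mul_qm hq]
  rw [h3]
  exact ⟨hab, h2⟩

theorem contDiff_row (q : Mat2) : ContDiff ℝ ∞ (row q) := by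
  let L : Mat2 →ₗ[ℝ] ℂ × ℂ :=
    { toFun := row q
      map_add' := fun A B => by simp [row, Matrix.mul_add]
      map_smul' := fun c A => by simp [row] }
  exact (LinearMap.toContinuousLinearMap L).contDiff

theorem contDiff_rowCoord (c d : ℂ) : ContDiff ℝ ∞ (rowCoord c d) := by
  have h1 : ContDiff ℝ ∞ fun x : ℂ × ℂ => d * x.2 := contDiff_const.mul contDiff_snd
  have h2 : ContDiff ℝ ∞ fun x : ℂ × ℂ => c * x.1 := contDiff_const.mul contDiff_fst
  exact (Complex.reCLM.contDiff.comp h1).prodMk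
    ((Complex.imCLM.contDiff.comp h2).prodMk (Complex.imCLM.contDiff.comp h1))

/-- Inverse of `rowCoord` on the half sphere `0 < Re (c a)`. -/
def rowOfCoord (c d : ℂ) (y : ℝ × ℝ × ℝ) : ℂ × ℂ :=
  (star c * (Real.sqrt (1 - (y.1 ^ 2 + y.2.1 ^ 2 + y.2.2 ^ 2)) + y.2.1 * Complex.I),
    star d * (y.1 + y.2.2 * Complex.I))

/-- The open unit ball of `ℝ³`. -/
def unitBall : Set (ℝ × ℝ × ℝ) := {y | y.1 ^ 2 + y.2.1 ^ 2 + y.2.2 ^ 2 < 1}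

theorem isOpen_unitBall : IsOpen unitBall := isOpen_lt (by fun_prop) continuous_const

theorem contDiffOn_rowOfCoord (c d : ℂ) : ContDiffOn ℝ ∞ (rowOfCoord c d) unitBall := by
  have h1 : ContDiffOn ℝ ∞ (fun y : ℝ × ℝ × ℝ =>
      Real.sqrt (1 - (y.1 ^ 2 + y.2.1 ^ 2 + y.2.2 ^ 2))) unitBall := by
    intro y hy
    have : 1 - (y.1 ^ 2 + y.2.1 ^ 2 + y.2.2 ^ 2) ≠ 0 := (sub_pos.2 hy).ne'
    have h : ContDiff ℝ ∞ fun y : ℝ × ℝ × ℝ => 1 - (y.1 ^ 2 + y.2.1 ^ 2 + y.2.2 ^ 2) := by fun_prop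
    exact (h.contDiffAt.sqrt this).contDiffWithinAt
  have h2 : ContDiff ℝ ∞ (fun y : ℝ × ℝ × ℝ => (y.1 : ℂ) + y.2.2 * Complex.I) :=
    (Complex.ofRealCLM.contDiff.comp contDiff_fst).add
      ((Complex.ofRealCLM.contDiff.comp (contDiff_snd.comp contDiff_snd)).mul contDiff_const)
  have h3 : ContDiff ℝ ∞ (fun y : ℝ × ℝ × ℝ => (y.2.1 : ℂ) * Complex.I) :=
    (Complex.ofRealCLM.contDiff.comp (contDiff_fst.comp contDiff_snd)).mul contDiff_const
  exact (contDiffOn_const.mul ((Complex.ofRealCLM.contDiff.comp_contDiffOn h1).add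
    h3.contDiffOn)).prodMk (contDiff_const.mul h2).contDiffOn

theorem mul_star_of_normSq {c : ℂ} (hc : Complex.normSq c = 1) : c * star c = 1 := by
  rw [mul_star_self, hc, Complex.ofReal_one]

theorem mul_star_mul {c : ℂ} (hc : Complex.normSq c = 1) (x : ℂ) : c * (star c * x) = x := by
  rw [← mul_assoc, mul_star_of_normSq hc, one_mul]

theorem star_mul_mul {c : ℂ} (hc : Complex.normSq c = 1) (x : ℂ) : star c * (c * x) = x := by
  rw [← mul_assoc, mul_comm (star c), mul_star_of_normSq hc, one_mul]

theorem normSq_rowOfCoord {c d : ℂ} (hc : Complex.normSq c = 1) (hd : Complex.normSq d = 1)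
    {y : ℝ × ℝ × ℝ} (hy : y ∈ unitBall) :
    Complex.normSq (rowOfCoord c d y).1 + Complex.normSq (rowOfCoord c d y).2 = 1 := by
  have : 0 ≤ 1 - (y.1 ^ 2 + y.2.1 ^ 2 + y.2.2 ^ 2) := (sub_pos.2 hy).le
  rw [rowOfCoord, Complex.normSq_mul, Complex.normSq_mul, normSq_star, normSq_star, hc, hd, one_mul,
    one_mul, Complex.normSq_add_mul_I, Complex.normSq_add_mul_I, Real.sq_sqrt this]
  ring

theorem rowCoord_rowOfCoord {c d : ℂ} (hc : Complex.normSq c = 1) (hd : Complex.normSq d = 1)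
    (y : ℝ × ℝ × ℝ) : rowCoord c d (rowOfCoord c d y) = y := by
  simp only [rowCoord, rowOfCoord, mul_star_mul hc, mul_star_mul hd]
  ext <;> simp

/-- On the unit sphere the omitted coordinate `Re (c a)` is recovered from the other three as the
positive square root. -/
theorem rowCoord_mem {c d : ℂ} (hc : Complex.normSq c = 1) (hd : Complex.normSq d = 1)
    {x : ℂ × ℂ} (hx : Complex.normSq x.1 + Complex.normSq x.2 = 1) (hpos : 0 < (c * x.1).re) :
    rowCoord c d x ∈ unitBall ∧ rowOfCoord c d (rowCoord c d x) = x := by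
  have h1 : (c * x.1).re ^ 2 + (c * x.1).im ^ 2 = Complex.normSq x.1 := by
    rw [← one_mul (Complex.normSq x.1), ← hc, ← Complex.normSq_mul, Complex.normSq_apply]; ring
  have h2 : (d * x.2).re ^ 2 + (d * x.2).im ^ 2 = Complex.normSq x.2 := by
    rw [← one_mul (Complex.normSq x.2), ← hd, ← Complex.normSq_mul, Complex.normSq_apply]; ring
  constructor
  · change (d * x.2).re ^ 2 + (c * x.1).im ^ 2 + (d * x.2).im ^ 2 < 1
    nlinarith
  · have h3 : Real.sqrt (1 - ((d * x.2).re ^ 2 + (c * x.1).im ^ 2 + (d * x.2).im ^ 2)) =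
        (c * x.1).re := by
      rw [Real.sqrt_eq_iff_mul_self_eq_of_pos hpos]; linarith
    simp only [rowOfCoord, rowCoord, h3, Complex.re_add_im, star_mul_mul hc, star_mul_mul hd]

open Classical in
/-- The chart of `SU(2)` given by three real coordinates of the first row. -/
def baseChart (q : SU2) {c d : ℂ} (hc : Complex.normSq c = 1) (hd : Complex.normSq d = 1) :
    OpenPartialHomeomorph SU2 (ℝ × ℝ × ℝ) where
  toFun g := rowCoord c d (row q g)
  invFun y := if h : y ∈ unitBall then
    ⟨q * qm (rowOfCoord c d y).1 (rowOfCoord c d y).2,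
      mul_mem q.2 (qm_mem (normSq_rowOfCoord hc hd h))⟩ else q
  source := {g | 0 < (c * (row q g).1).re}
  target := unitBall
  map_source' g hg := (rowCoord_mem hc hd (exists_row q.2 g.2).1 hg).1
  map_target' y hy := by
    rw [dif_pos hy, mem_ofPred_eq, row_mul_qm q.2]
    simp only [rowOfCoord, mul_star_mul hc]
    have : 0 < 1 - (y.1 ^ 2 + y.2.1 ^ 2 + y.2.2 ^ 2) := sub_pos.2 hy
    simpa using this
  left_inv' g hg := by
    obtain ⟨h1, h2⟩ := rowCoord_mem hc hd (exists_row q.2 g.2).1 hg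
    rw [dif_pos h1]
    apply Subtype.ext
    simp only [h2]
    exact (exists_row q.2 g.2).2.symm
  right_inv' y hy := by
    rw [dif_pos hy]
    simp only
    rw [row_mul_qm q.2, rowCoord_rowOfCoord hc hd]
  open_source := by
    have : Continuous fun g : SU2 => (c * (row q g).1).re :=
      Complex.continuous_re.comp (continuous_const.mul
        (continuous_fst.comp ((contDiff_row q).continuous.comp continuous_subtype_val)))
    exact isOpen_lt continuous_const this
  open_target := isOpen_unitBall
  continuousOn_toFun := ((contDiff_rowCoord c d).continuous.comp
    ((contDiff_row q).continuous.comp continuous_subtype_val)).continuousOn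
  continuousOn_invFun := by
    rw [IsInducing.subtypeVal.continuousOn_iff]
    have h1 : ContinuousOn (fun y => (q : Mat2) * qmL (rowOfCoord c d y)) unitBall :=
      (contDiff_matMul contDiff_const
        (LinearMap.toContinuousLinearMap qmL).contDiff (n := ∞)).continuous.comp_continuousOn
          (contDiffOn_rowOfCoord c d).continuousOn
    refine h1.congr fun y hy => ?_
    simp only [Function.comp_apply]
    rw [dif_pos hy]
    rfl

open Classical in
theorem coe_baseChart_symm (q : SU2) {c d : ℂ} (hc : Complex.normSq c = 1)
    (hd : Complex.normSq d = 1) {y : ℝ × ℝ × ℝ} (hy : y ∈ unitBall) :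
    ((baseChart q hc hd).symm y : Mat2) = q * qmL (rowOfCoord c d y) := by
  change (((if h : y ∈ unitBall then _ else _ : SU2)) : Mat2) = _
  rw [dif_pos hy]
  rfl

theorem isGroupChart_baseChart_trans (q : SU2) {c d : ℂ} (hc : Complex.normSq c = 1)
    (hd : Complex.normSq d = 1) (e : OpenPartialHomeomorph (ℝ × ℝ × ℝ) (ℝ × ℝ × ℝ))
    (he : ContDiffOn ℝ ∞ e e.source) (he' : ContDiffOn ℝ ∞ e.symm e.target) :
    IsGroupChart ((baseChart q hc hd).trans e) := by
  have hF : ContDiff ℝ ∞ fun g : Mat2 => rowCoord c d (row q g) :=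
    (contDiff_rowCoord c d).comp (contDiff_row q)
  constructor
  · rw [OpenPartialHomeomorph.trans_target]
    have h1 : ContDiffOn ℝ ∞ (fun y => (q : Mat2) * qmL (rowOfCoord c d (e.symm y)))
        (e.target ∩ e.symm ⁻¹' unitBall) :=
      (contDiff_matMul contDiff_const
        (LinearMap.toContinuousLinearMap qmL).contDiff (n := ∞)).comp_contDiffOn
          ((contDiffOn_rowOfCoord c d).comp (he'.mono inter_subset_left) fun y hy => hy.2)
    exact h1.congr fun y hy => coe_baseChart_symm q hc hd hy.2
  · intro g hg
    rw [OpenPartialHomeomorph.trans_source] at hg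
    refine ⟨(fun g : Mat2 => rowCoord c d (row q g)) ⁻¹' e.source,
      e.open_source.preimage hF.continuous, hg.2, fun g => e (rowCoord c d (row q g)),
      he.comp hF.contDiffOn fun x hx => hx, fun h _ _ => rfl⟩

/-- Equivalence of germs in coordinates gives equivalence of the exponential map. -/
theorem expEquivalentAt_of_coord (q : SU2) (p : cotangentSpace q) {x₀ : ℂ × ℝ}
    (hx₀ : covEquiv q p = x₀) {c d : ℂ} (hc : Complex.normSq c = 1) (hd : Complex.normSq d = 1)
    (hpos : 0 < (c * (expRow x₀).1).re) (hcont : ContinuousAt expRow x₀)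
    {h : ℂ × ℝ → ℝ × ℝ × ℝ} (hh : IsLocDiffeo h x₀) (h0 : h x₀ = 0)
    {θ : ℝ × ℝ × ℝ → ℝ × ℝ × ℝ} (hθ : IsLocDiffeo θ (rowCoord c d (expRow x₀)))
    (hθ0 : θ (rowCoord c d (expRow x₀)) = 0) {f : ℝ × ℝ × ℝ → ℝ × ℝ × ℝ}
    (hf : ∀ᶠ x in 𝓝 x₀, θ (rowCoord c d (expRow x)) = f (h x)) :
    ExpEquivalentAt q p f := by
  obtain ⟨e, he, he1, he2, he3⟩ := hh
  obtain ⟨k, hk, hk1, hk2, hk3⟩ := hθ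
  have hrow : ∀ p, row q (srExp q p) = expRow (covEquiv q p) := fun p => by
    rw [coe_srExp, row_mul_qm q.2]
  have ev1 : ∀ᶠ x in 𝓝 x₀, 0 < (c * (expRow x).1).re :=
    (Complex.continuous_re.continuousAt.comp (continuousAt_const.mul hcont.fst)).eventually
      (lt_mem_nhds hpos)
  have ev2 : ∀ᶠ x in 𝓝 x₀, rowCoord c d (expRow x) ∈ k.source :=
    ((contDiff_rowCoord c d).continuous.continuousAt.comp hcont).eventually
      (k.open_source.mem_nhds hk)
  -- Restricting the covector chart to `O` makes the image stay in the group chart and the normal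
  -- form hold on the whole source.
  obtain ⟨O, hO, hOo, hxO⟩ := mem_nhds_iff.1 (ev1.and (ev2.and hf))
  let χ := (covEquiv q).toHomeomorph.toOpenPartialHomeomorph.trans (e.restrOpen O hOo)
  have hsrc : ∀ p, p ∈ χ.source ↔ covEquiv q p ∈ e.source ∧ covEquiv q p ∈ O := by
    intro p
    simp [χ]
  have hval : ∀ p, χ p = e (covEquiv q p) := fun _ => rfl
  have htgt : χ.target ⊆ e.target := by
    intro y hy
    rw [← χ.right_inv hy, hval]
    exact e.map_source ((hsrc _).1 (χ.map_target hy)).1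
  have hψsrc : ∀ p ∈ χ.source, srExp q p ∈ ((baseChart q hc hd).trans k).source := by
    intro p hp
    have hpO := hO ((hsrc p).1 hp).2
    rw [OpenPartialHomeomorph.trans_source]
    refine ⟨?_, ?_⟩
    · change 0 < (c * (row q (srExp q p)).1).re
      rw [hrow]; exact hpO.1
    · change rowCoord c d (row q (srExp q p)) ∈ k.source
      rw [hrow]; exact hpO.2.1
  have hψval : ∀ p ∈ χ.source, (baseChart q hc hd).trans k (srExp q p) =
      θ (rowCoord c d (expRow (covEquiv q p))) := by
    intro p hp
    change k (rowCoord c d (row q (srExp q p))) = _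
    rw [hrow, hk3 (hO ((hsrc p).1 hp).2).2.1]
  have hpχ : p ∈ χ.source := (hsrc p).2 (by rw [hx₀]; exact ⟨he, hxO⟩)
  refine ⟨χ, (baseChart q hc hd).trans k, ⟨?_, ?_⟩,
    isGroupChart_baseChart_trans q hc hd k hk1 hk2, hpχ, ?_, hψsrc p hpχ, ?_, hψsrc, ?_⟩
  · exact he1.comp (covEquiv q).contDiff.contDiffOn fun p hp => ((hsrc p).1 hp).1
  · exact (covEquiv q).symm.contDiff.comp_contDiffOn (he2.mono htgt)
  · rw [hval, hx₀, he3 he, h0]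
  · rw [hψval p hpχ, hx₀, hθ0]
  · intro y hy
    have hs := χ.map_target hy
    rw [hψval _ hs, (hO ((hsrc _).1 hs).2).2.2, ← he3 ((hsrc _).1 hs).1, ← hval,
      χ.right_inv hy]

/-! ### The differential of the exponential map -/

/-- The quotient `sin (r / 2) / r`. -/
def sinQuot (r : ℝ) : ℝ := Real.sin (r / 2) / r

/-- The derivative of `sinQuot`. -/
def sinQuotDeriv (r : ℝ) : ℝ := (r * Real.cos (r / 2) - 2 * Real.sin (r / 2)) / (2 * r ^ 2)

theorem hasDerivAt_sinQuot {r : ℝ} (hr : r ≠ 0) : HasDerivAt sinQuot (sinQuotDeriv r) r := by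
  have h := (((hasDerivAt_id r).div_const 2).sin).div (hasDerivAt_id r) hr
  refine h.congr_deriv ?_
  simp only [id, sinQuotDeriv]
  field_simp

/-- The unit complex number `exp (i x)`. -/
def expI (x : ℝ) : ℂ := Complex.exp (x * Complex.I)

theorem normSq_expI (x : ℝ) : Complex.normSq (expI x) = 1 := normSq_exp_ofReal_mul_I x

theorem expI_ne_zero (x : ℝ) : expI x ≠ 0 := Complex.exp_ne_zero _

theorem expI_mul_expI_neg (x : ℝ) : expI x * expI (-x) = 1 := by
  rw [expI, expI, ← Complex.exp_add]; simp

theorem contDiff_expI : ContDiff ℝ ∞ expI :=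
  Complex.contDiff_exp.comp (Complex.ofRealCLM.contDiff.mul contDiff_const)

theorem hasDerivAt_expI (x : ℝ) : HasDerivAt expI (expI x * Complex.I) x := by
  have : HasDerivAt (fun t : ℝ => (t : ℂ)) 1 x := (hasDerivAt_id x).ofReal_comp
  have h := (this.mul_const Complex.I).cexp
  rw [one_mul] at h
  exact h

theorem expRow_eq (x : ℂ × ℝ) : expRow x =
    ((Real.cos (len x.1 x.2 / 2) + Complex.I * (x.2 * sinQuot (len x.1 x.2) : ℝ)) *
      expI (-(x.2 / 2)), x.1 * (sinQuot (len x.1 x.2) : ℝ) * expI (x.2 / 2)) := by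
  simp only [expRow, flowA, flowB, sinQuot, expI, mul_one]
  push_cast
  congr 1
  ring

theorem hasDerivAt_line {E : Type*} [NormedAddCommGroup E] [NormedSpace ℝ E] (x v : E) :
    HasDerivAt (fun t : ℝ => x + t • v) v 0 :=
  (((hasDerivAt_id (0 : ℝ)).smul_const v).const_add x).congr_deriv (one_smul ℝ v)

/-- The directional derivative of the length. -/
def lenDeriv (x v : ℂ × ℝ) : ℝ :=
  (x.1.re * v.1.re + x.1.im * v.1.im + x.2 * v.2) / len x.1 x.2

/-- The directional derivative of `expRow`. -/
def rowDeriv (x v : ℂ × ℝ) : ℂ × ℂ :=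
  (expI (-(x.2 / 2)) *
      ((sinQuot (len x.1 x.2) / 2 * (x.2 * v.2 - len x.1 x.2 * lenDeriv x v) : ℝ) +
        (sinQuotDeriv (len x.1 x.2) * (x.2 * lenDeriv x v - len x.1 x.2 * v.2) : ℝ) * Complex.I),
    expI (x.2 / 2) * (v.1 * (sinQuot (len x.1 x.2) : ℝ) +
      x.1 * ((sinQuotDeriv (len x.1 x.2) * lenDeriv x v : ℝ) +
        (sinQuot (len x.1 x.2) / 2 * v.2 : ℝ) * Complex.I)))

theorem contDiffAt_len {x : ℂ × ℝ} (hx : len x.1 x.2 ≠ 0) :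
    ContDiffAt ℝ ∞ (fun x : ℂ × ℝ => len x.1 x.2) x := by
  have h1 : ContDiff ℝ ∞ fun x : ℂ × ℝ => Complex.normSq x.1 + x.2 ^ 2 := by
    have hr : ContDiff ℝ ∞ fun x : ℂ × ℝ => x.1.re := Complex.reCLM.contDiff.comp contDiff_fst
    have hi : ContDiff ℝ ∞ fun x : ℂ × ℝ => x.1.im := Complex.imCLM.contDiff.comp contDiff_fst
    simp only [Complex.normSq_apply]
    exact ((hr.mul hr).add (hi.mul hi)).add (contDiff_snd.pow 2)
  refine h1.contDiffAt.sqrt fun h => hx ?_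
  rw [len, h, Real.sqrt_zero]

theorem hasDerivAt_len {x : ℂ × ℝ} (hx : len x.1 x.2 ≠ 0) (v : ℂ × ℝ) :
    HasDerivAt (fun t : ℝ => len (x + t • v).1 (x + t • v).2) (lenDeriv x v) 0 := by
  have hl := hasDerivAt_line x v
  have h1 : HasDerivAt (fun t : ℝ => (x + t • v).1.re) v.1.re 0 :=
    Complex.reCLM.hasFDerivAt.comp_hasDerivAt 0 hl.fst
  have h2 : HasDerivAt (fun t : ℝ => (x + t • v).1.im) v.1.im 0 :=
    Complex.imCLM.hasFDerivAt.comp_hasDerivAt 0 hl.fst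
  have h3 : HasDerivAt (fun t : ℝ => (x + t • v).2) v.2 0 := hl.snd
  have h4 := ((h1.mul h1).add (h2.mul h2)).add (h3.pow 2)
  have h5 := h4.sqrt (by
    intro h
    apply hx
    simp only [Pi.add_apply, Pi.mul_apply, Pi.pow_apply, zero_smul, add_zero] at h
    rw [len, Complex.normSq_apply, h, Real.sqrt_zero])
  simp only [Pi.add_apply, Pi.mul_apply, Pi.pow_apply, ← Complex.normSq_apply] at h5
  change HasDerivAt (fun t : ℝ => len (x + t • v).1 (x + t • v).2) _ 0 at h5
  refine h5.congr_deriv ?_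
  simp only [zero_smul, add_zero, lenDeriv]
  change _ / (2 * len x.1 x.2) = _
  field_simp
  simp
  ring

theorem hasDerivAt_expRow {x : ℂ × ℝ} (hx : len x.1 x.2 ≠ 0) (v : ℂ × ℝ) :
    HasDerivAt (fun t : ℝ => expRow (x + t • v)) (rowDeriv x v) 0 := by
  have hl := hasDerivAt_line x v
  have hz : HasDerivAt (fun t : ℝ => (x + t • v).1) v.1 0 := hl.fst
  have hw : HasDerivAt (fun t : ℝ => (x + t • v).2) v.2 0 := hl.snd
  have hr := hasDerivAt_len hx v
  have hr0 : len (x + (0 : ℝ) • v).1 (x + (0 : ℝ) • v).2 = len x.1 x.2 := by simp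
  have hs : HasDerivAt (fun t : ℝ => sinQuot (len (x + t • v).1 (x + t • v).2))
      (sinQuotDeriv (len x.1 x.2) * lenDeriv x v) 0 := by
    have := hasDerivAt_sinQuot hx
    rw [← hr0] at this
    exact (this.comp (0 : ℝ) hr).congr_deriv (by rw [hr0])
  have hc : HasDerivAt (fun t : ℝ => Real.cos (len (x + t • v).1 (x + t • v).2 / 2))
      (-Real.sin (len x.1 x.2 / 2) * (lenDeriv x v / 2)) 0 :=
    (hr.div_const 2).cos.congr_deriv (by rw [hr0])
  have he1 : HasDerivAt (fun t : ℝ => expI (-((x + t • v).2 / 2)))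
      (expI (-(x.2 / 2)) * Complex.I * (-(v.2 / 2) : ℝ)) 0 := by
    have := (hasDerivAt_expI (-((x + (0 : ℝ) • v).2 / 2))).scomp (0 : ℝ) (hw.div_const 2).neg
    refine this.congr_deriv ?_
    simp [mul_comm]
  have he2 : HasDerivAt (fun t : ℝ => expI ((x + t • v).2 / 2))
      (expI (x.2 / 2) * Complex.I * (v.2 / 2 : ℝ)) 0 := by
    have := (hasDerivAt_expI ((x + (0 : ℝ) • v).2 / 2)).scomp (0 : ℝ) (hw.div_const 2)
    refine this.congr_deriv ?_
    simp [mul_comm]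
  have key := ((hc.ofReal_comp.add ((hw.mul hs).ofReal_comp.const_mul Complex.I)).mul he1).prodMk
    ((hz.mul hs.ofReal_comp).mul he2)
  have hfun : (fun t : ℝ => expRow (x + t • v)) = fun t => _ := funext fun t => expRow_eq _
  rw [hfun]
  refine key.congr_deriv ?_
  simp only [rowDeriv, zero_smul, add_zero, Pi.add_apply, Pi.mul_apply]
  set r := len x.1 x.2
  -- Once sine and cosine are expressed through `sinQuot` and `sinQuotDeriv`, the claim is a
  -- polynomial identity modulo `I ^ 2 = -1`.
  have hS : Real.sin (r / 2) = r * sinQuot r := by rw [sinQuot]; field_simp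
  have hC : Real.cos (r / 2) = 2 * sinQuot r + 2 * r * sinQuotDeriv r := by
    rw [sinQuot, sinQuotDeriv]; field_simp; ring
  rw [hS, hC]
  push_cast
  ext1
  · ring_nf
    simp only [Complex.I_sq]
    ring
  · ring

theorem contDiffAt_expRow {x : ℂ × ℝ} (hx : len x.1 x.2 ≠ 0) : ContDiffAt ℝ ∞ expRow x := by
  have hr := contDiffAt_len hx
  have hw : ContDiffAt ℝ ∞ (fun x : ℂ × ℝ => x.2) x := contDiff_snd.contDiffAt
  have hc : ContDiffAt ℝ ∞ (fun x : ℂ × ℝ => Real.cos (len x.1 x.2 / 2)) x :=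
    (hr.div_const 2).cos
  have hs : ContDiffAt ℝ ∞ (fun x : ℂ × ℝ => sinQuot (len x.1 x.2)) x :=
    ((hr.div_const 2).sin).div hr hx
  have he1 : ContDiffAt ℝ ∞ (fun x : ℂ × ℝ => expI (-(x.2 / 2))) x :=
    contDiff_expI.contDiffAt.comp x (hw.div_const 2).neg
  have he2 : ContDiffAt ℝ ∞ (fun x : ℂ × ℝ => expI (x.2 / 2)) x :=
    contDiff_expI.contDiffAt.comp x (hw.div_const 2)
  have hof : ContDiff ℝ ∞ (fun x : ℝ => (x : ℂ)) := Complex.ofRealCLM.contDiff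
  rw [funext expRow_eq]
  exact (((hof.contDiffAt.comp x hc).add (contDiffAt_const.mul
    (hof.contDiffAt.comp x (hw.mul hs)))).mul he1).prodMk
    ((contDiff_fst.contDiffAt.mul (hof.contDiffAt.comp x hs)).mul he2)

/-- The unit factors `expI` drop out and the first entry splits into real and imaginary parts; this
isolates `sinQuot` and `sinQuotDeriv`, whose zeros give the two strata. -/
theorem rowDeriv_eq_zero_iff (x v : ℂ × ℝ) : rowDeriv x v = 0 ↔
    sinQuot (len x.1 x.2) * (x.2 * v.2 - len x.1 x.2 * lenDeriv x v) = 0 ∧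
    sinQuotDeriv (len x.1 x.2) * (x.2 * lenDeriv x v - len x.1 x.2 * v.2) = 0 ∧
    v.1 * (sinQuot (len x.1 x.2) : ℝ) + x.1 * ((sinQuotDeriv (len x.1 x.2) * lenDeriv x v : ℝ) +
        (sinQuot (len x.1 x.2) / 2 * v.2 : ℝ) * Complex.I) = 0 := by
  rw [rowDeriv, Prod.mk_eq_zero, mul_eq_zero, mul_eq_zero, or_iff_right (expI_ne_zero _),
    or_iff_right (expI_ne_zero _), ← and_assoc]
  refine and_congr_left fun _ => ?_
  rw [Complex.ext_iff]
  simp only [Complex.add_re, Complex.add_im, Complex.ofReal_re, Complex.ofReal_im,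
    Complex.re_ofReal_mul, Complex.im_ofReal_mul, Complex.I_re, Complex.I_im, mul_zero, mul_one,
    add_zero, zero_add, Complex.zero_re, Complex.zero_im]
  refine and_congr_left fun _ => ?_
  constructor <;> intro h <;> linarith

theorem len_ne_zero {x : ℂ × ℝ} (hx : x.1 ≠ 0) : len x.1 x.2 ≠ 0 :=
  fun h => hx (eq_zero_of_len h).1

theorem sinQuotDeriv_ne_zero {r : ℝ} (hr : r ≠ 0) (hs : Real.sin (r / 2) = 0) :
    sinQuotDeriv r ≠ 0 := by
  have hc : Real.cos (r / 2) ≠ 0 := by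
    intro hc
    have := Real.sin_sq_add_cos_sq (r / 2)
    rw [hs, hc] at this
    norm_num at this
  rw [sinQuotDeriv, hs]
  have : 2 * r ^ 2 ≠ 0 := by positivity
  exact div_ne_zero (by simpa using ⟨hr, hc⟩) this

/-- Off both strata, with `σ = lenDeriv x v` and `ω = v.2`, one has `w ω = r σ` and `w σ = r ω`.
Hence `(r² - w²) σ = |z|² σ = 0`, so `σ = ω = 0`, and the last equation gives `v.1 = 0`. -/
theorem exists_rowDeriv_eq_zero_iff {x : ℂ × ℝ} (hx : x.1 ≠ 0) :
    (∃ v, v ≠ 0 ∧ rowDeriv x v = 0) ↔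
      len x.1 x.2 * Real.cos (len x.1 x.2 / 2) = 2 * Real.sin (len x.1 x.2 / 2) ∨
        Real.sin (len x.1 x.2 / 2) = 0 := by
  have hr := len_ne_zero hx
  have hsq := len_sq x.1 x.2
  have hn : 0 < Complex.normSq x.1 := Complex.normSq_pos.2 hx
  simp only [rowDeriv_eq_zero_iff]
  set r := len x.1 x.2 with hrdef
  constructor
  · rintro ⟨v, hv, h1, h2, h3⟩
    by_contra! hcon
    have hs : sinQuot r ≠ 0 := div_ne_zero hcon.2 hr
    have hs' : sinQuotDeriv r ≠ 0 :=
      div_ne_zero (sub_ne_zero.2 hcon.1) (by positivity)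
    have e1 := (mul_eq_zero.1 h1).resolve_left hs
    have e2 := (mul_eq_zero.1 h2).resolve_left hs'
    have e3 : Complex.normSq x.1 * lenDeriv x v = 0 := by
      have : Complex.normSq x.1 = r ^ 2 - x.2 ^ 2 := by linarith
      rw [this]; linear_combination -r * e1 - x.2 * e2
    have e4 := (mul_eq_zero.1 e3).resolve_left hn.ne'
    rw [e4, mul_zero, zero_sub, neg_eq_zero] at e2
    have e5 := (mul_eq_zero.1 e2).resolve_left hr
    rw [e4, e5] at h3
    simp only [mul_zero, Complex.ofReal_zero, zero_mul, add_zero] at h3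
    exact hv (Prod.ext ((mul_eq_zero.1 h3).resolve_right (by exact_mod_cast hs)) e5)
  · rintro (h | h)
    · have hs' : sinQuotDeriv r = 0 := by rw [sinQuotDeriv, h, sub_self, zero_div]
      -- To first order this direction changes `w` and turns `z` so that the phase of `z e^{iw/2}`
      -- stays fixed.
      refine ⟨(-(x.1 * (Complex.I / 2)), 1), fun h => one_ne_zero (congrArg Prod.snd h), ?_⟩
      have hl : r * lenDeriv x (-(x.1 * (Complex.I / 2)), 1) = x.2 := by
        rw [lenDeriv, ← hrdef, mul_div_cancel₀ _ hr]
        simp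
        ring
      rw [hl, hs']
      refine ⟨by ring, by ring, ?_⟩
      push_cast; ring
    · have hs : sinQuot r = 0 := by rw [sinQuot, h, zero_div]
      -- Rotation of `z`: it preserves `r` and `w`, and the second entry is `0` here whatever the
      -- phase of `z`.
      refine ⟨(x.1 * Complex.I, 0), fun h => ?_, ?_⟩
      · have := congrArg Prod.fst h
        simp [hx] at this
      · have hl : lenDeriv x (x.1 * Complex.I, 0) = 0 := by
          rw [lenDeriv]
          simp
          exact Or.inl (by ring)
        rw [hl, hs]
        simp

/-- In linear coordinates the differential is `rowDeriv` followed by the injective map `y ↦ q * qmL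
y`, so the two kernels correspond. It exists because `expRow` is smooth where `r ≠ 0`. -/
theorem mem_conjugateLocus_iff (q : SU2) (p : cotangentSpace q) (hp : (covEquiv q p).1 ≠ 0) :
    p ∈ conjugateLocus q ↔ ∃ v, v ≠ 0 ∧ rowDeriv (covEquiv q p) v = 0 := by
  have hr := len_ne_zero hp
  have hrow : ContDiffAt ℝ ∞ (fun p' => expRow (covEquiv q p')) p :=
    (contDiffAt_expRow hr).comp p (covEquiv q).contDiff.contDiffAt
  have hexp : ContDiffAt ℝ ∞ (fun p' => (srExp q p' : Mat2)) p := by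
    have h1 : (fun p' => (srExp q p' : Mat2)) = fun p' => (q : Mat2) * qmL (expRow (covEquiv q p')) :=
      funext fun p' => coe_srExp q p'
    rw [h1]
    exact (contDiff_matMul contDiff_const
      (LinearMap.toContinuousLinearMap qmL).contDiff (n := ∞)).contDiffAt.comp p hrow
  have hval : ∀ L : cotangentSpace q →L[ℝ] Mat2, HasFDerivAt (fun p' => (srExp q p' : Mat2)) L p →
      ∀ v, L v = q * qmL (rowDeriv (covEquiv q p) (covEquiv q v)) := by
    intro L hL v
    have hl := hasDerivAt_line p v
    have hL0 : HasFDerivAt (fun p' => (srExp q p' : Mat2)) L (p + (0 : ℝ) • v) := by simpa using hL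
    have h1 := hL0.comp_hasDerivAt 0 hl
    have h2 := hasDerivAt_matMul (hasDerivAt_const (0 : ℝ) (q : Mat2))
      ((LinearMap.toContinuousLinearMap qmL).hasFDerivAt.comp_hasDerivAt 0
        (hasDerivAt_expRow hr (covEquiv q v)))
    rw [zero_mul, zero_add] at h2
    refine h1.unique (h2.congr_of_eventuallyEq (Eventually.of_forall fun t => ?_))
    change (srExp q (p + t • v) : Mat2) = q * qmL (expRow (covEquiv q p + t • covEquiv q v))
    rw [coe_srExp, map_add, map_smul]
    rfl
  have hzero : ∀ y : ℂ × ℂ, (q : Mat2) * qmL y = 0 ↔ y = 0 := by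
    intro y
    constructor
    · intro h
      have : row q ((q : Mat2) * qm y.1 y.2) = row q 0 := congrArg _ h
      rw [row_mul_qm q.2] at this
      exact this.trans (by simp [row])
    · rintro rfl
      rw [map_zero, mul_zero]
  constructor
  · rintro ⟨-, L, hL, hker⟩
    obtain ⟨v, hv, hv0⟩ := (Submodule.ne_bot_iff _).1 hker
    have h1 : L v = 0 := hv
    rw [hval L hL, hzero] at h1
    exact ⟨covEquiv q v, by simpa using hv0, h1⟩
  · rintro ⟨v, hv0, hv⟩
    have hL := (hexp.differentiableAt (by simp)).hasFDerivAt
    refine ⟨by rw [expDomain_eq_univ]; trivial, _, hL, (Submodule.ne_bot_iff _).2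
      ⟨(covEquiv q).symm v, ?_, by simpa using hv0⟩⟩
    change fderiv ℝ (fun p' => (srExp q p' : Mat2)) p ((covEquiv q).symm v) = 0
    refine (hval _ hL _).trans ?_
    rw [hzero, ContinuousLinearEquiv.apply_symm_apply, hv]

theorem mem_conjugateLocus_iff_mem_strata (q : SU2) (p : cotangentSpace q)
    (hp : (covEquiv q p).1 ≠ 0) : p ∈ conjugateLocus q ↔ p ∈ C0 q ∪ C1 q := by
  have hp0 : p ≠ 0 := by
    rintro rfl
    simp at hp
  rw [mem_conjugateLocus_iff q p hp, exists_rowDeriv_eq_zero_iff hp, ← covNorm_eq_len]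
  simp [C0, C1, hp0]

/-! ### The normal form along the second stratum -/

theorem isLocDiffeo_linearEquiv {E F : Type*} [NormedAddCommGroup E] [NormedSpace ℝ E]
    [NormedAddCommGroup F] [NormedSpace ℝ F] [CompleteSpace E] (e : E ≃L[ℝ] F) (a : E) :
    IsLocDiffeo e a :=
  isLocDiffeo_of_hasFDerivAt isOpen_univ (mem_univ a) e.contDiff.contDiffOn e e.hasFDerivAt

/-- Exchange of the first and third coordinates. -/
def swapOuter : (ℝ × ℝ × ℝ) ≃L[ℝ] (ℝ × ℝ × ℝ) :=
  (LinearEquiv.toContinuousLinearEquiv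
    { toFun := fun y => (y.2.2, y.2.1, y.1)
      invFun := fun y => (y.2.2, y.2.1, y.1)
      map_add' := fun _ _ => rfl
      map_smul' := fun _ _ => rfl
      left_inv := fun _ => rfl
      right_inv := fun _ => rfl })

theorem swapOuter_apply (y : ℝ × ℝ × ℝ) : swapOuter y = (y.2.2, y.2.1, y.1) := rfl

theorem hasDerivAt_re {f : ℝ → ℂ} {f' : ℂ} {t : ℝ} (h : HasDerivAt f f' t) :
    HasDerivAt (fun s => (f s).re) f'.re t := Complex.reCLM.hasFDerivAt.comp_hasDerivAt t h

theorem hasDerivAt_im {f : ℝ → ℂ} {f' : ℂ} {t : ℝ} (h : HasDerivAt f f' t) :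
    HasDerivAt (fun s => (f s).im) f'.im t := Complex.imCLM.hasFDerivAt.comp_hasDerivAt t h

/-- The second entry is the real factor `sinQuot`, which vanishes at the point, times the
nonvanishing `ζ`. Its real and imaginary parts therefore vanish together, and their ratio is the
smooth function `Im ζ / Re ζ`. -/
theorem expEquivalentAt_of_mem_C1 (q : SU2) (p : cotangentSpace q) (hp : p ∈ C1 q)
    (hz : (covEquiv q p).1 ≠ 0) :
    ExpEquivalentAt q p (fun v => (v.1 * v.2.2, v.2.1, v.2.2)) := by
  have hS := hp.2
  rw [covNorm_eq_len] at hS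
  obtain ⟨x₀, hx₀⟩ : ∃ x, covEquiv q p = x := ⟨_, rfl⟩
  rw [hx₀] at hS hz
  have hr := len_ne_zero hz
  have hs : sinQuot (len x₀.1 x₀.2) = 0 := by rw [sinQuot, hS, zero_div]
  have hs' := sinQuotDeriv_ne_zero hr hS
  have hC2 : Real.cos (len x₀.1 x₀.2 / 2) * Real.cos (len x₀.1 x₀.2 / 2) = 1 := by
    have := Real.sin_sq_add_cos_sq (len x₀.1 x₀.2 / 2)
    rw [hS] at this
    nlinarith
  set C := Real.cos (len x₀.1 x₀.2 / 2) with hC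
  set n := ‖x₀.1‖ with hn
  have hn0 : 0 < n := norm_pos_iff.2 hz
  have hnC : (n : ℂ) ≠ 0 := by exact_mod_cast hn0.ne'
  have hzz : star x₀.1 * x₀.1 = n * n := by
    rw [mul_comm, mul_star_self, Complex.normSq_eq_norm_sq]; push_cast; ring
  -- Here `C = ±1`. The rotations `c` and `d` are chosen so that at `x₀` the first entry becomes `1`
  -- and `ζ` becomes the positive number `‖z‖`.
  let c : ℂ := C * expI (x₀.2 / 2)
  let d : ℂ := star x₀.1 / n * expI (-(x₀.2 / 2))
  have hc : Complex.normSq c = 1 := by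
    rw [Complex.normSq_mul, normSq_expI, Complex.normSq_ofReal, hC2, mul_one]
  have hd : Complex.normSq d = 1 := by
    rw [Complex.normSq_mul, normSq_expI, Complex.normSq_div, normSq_star,
      Complex.normSq_ofReal, Complex.normSq_eq_norm_sq, ← hn, mul_one]
    field_simp
  have hce : c * expI (-(x₀.2 / 2)) = C := by
    change C * expI (x₀.2 / 2) * _ = _
    rw [mul_assoc, expI_mul_expI_neg, mul_one]
  have hde : d * expI (x₀.2 / 2) = star x₀.1 / n := by
    change star x₀.1 / n * expI (-(x₀.2 / 2)) * _ = _
    rw [mul_assoc, mul_comm (expI _), expI_mul_expI_neg, mul_one]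
  let ζ : ℂ × ℝ → ℂ := fun x => d * (x.1 * expI (x.2 / 2))
  have hζ0 : ζ x₀ = n := by
    change d * (x₀.1 * expI (x₀.2 / 2)) = _
    rw [mul_comm x₀.1, ← mul_assoc, hde, div_mul_eq_mul_div, hzz]
    field_simp
  have hζ : ContDiff ℝ ∞ ζ := contDiff_const.mul (contDiff_fst.mul
    (contDiff_expI.comp (contDiff_snd.div_const 2)))
  have hrow0 : expRow x₀ = (C * expI (-(x₀.2 / 2)), 0) := by
    rw [expRow_eq, hs, ← hC]; simp
  have hca0 : c * (expRow x₀).1 = 1 := by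
    rw [hrow0, mul_left_comm, hce, ← Complex.ofReal_mul, hC2, Complex.ofReal_one]
  have hdb : ∀ x, d * (expRow x).2 = (sinQuot (len x.1 x.2) : ℝ) * ζ x := by
    intro x; rw [expRow_eq]; simp only [ζ]; ring
  let h : ℂ × ℝ → ℝ × ℝ × ℝ := fun x =>
    ((ζ x).im / (ζ x).re, (c * (expRow x).1).im, (d * (expRow x).2).re)
  let U : Set (ℂ × ℝ) := {x | 0 < (ζ x).re}
  have hU : IsOpen U := isOpen_lt continuous_const (Complex.continuous_re.comp hζ.continuous)
  have hx₀U : x₀ ∈ U := by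
    change 0 < (ζ x₀).re
    rw [hζ0]; exact hn0
  have hh : ContDiffOn ℝ ∞ h U := by
    intro x hx
    have hxr : len x.1 x.2 ≠ 0 := by
      refine len_ne_zero fun h => ?_
      have hx' : 0 < (d * (x.1 * expI (x.2 / 2))).re := hx
      rw [h] at hx'
      simp at hx'
    have h1 := contDiffAt_expRow hxr
    have hre := Complex.reCLM.contDiff (n := ∞)
    have him := Complex.imCLM.contDiff (n := ∞)
    exact (((him.contDiffAt.comp x hζ.contDiffAt).div (hre.contDiffAt.comp x hζ.contDiffAt)
      (ne_of_gt hx)).prodMk ((him.contDiffAt.comp x (contDiffAt_const.mul h1.fst)).prodMk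
        (hre.contDiffAt.comp x (contDiffAt_const.mul h1.snd)))).contDiffWithinAt
  have hloc : IsLocDiffeo h x₀ := by
    refine isLocDiffeo_of_injective (by simp) hU hx₀U hh fun v hv => ?_
    have hd0 : HasFDerivAt h (fderiv ℝ h x₀) (x₀ + (0 : ℝ) • v) := by
      rw [zero_smul, add_zero]
      exact ((hh.contDiffAt (hU.mem_nhds hx₀U)).differentiableAt (by simp)).hasFDerivAt
    have hl := hasDerivAt_line x₀ v
    have h1 := hd0.comp_hasDerivAt 0 hl
    rw [hv] at h1
    have hR := hasDerivAt_expRow hr v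
    have hR1 : HasDerivAt (fun t : ℝ => (expRow (x₀ + t • v)).1) (rowDeriv x₀ v).1 0 := hR.fst
    have hR2 : HasDerivAt (fun t : ℝ => (expRow (x₀ + t • v)).2) (rowDeriv x₀ v).2 0 := hR.snd
    have e2 : (c * (rowDeriv x₀ v).1).im = 0 :=
      (hasDerivAt_im (hR1.const_mul c)).unique h1.snd.fst
    have e3 : (d * (rowDeriv x₀ v).2).re = 0 :=
      (hasDerivAt_re (hR2.const_mul d)).unique h1.snd.snd
    -- As `sinQuot` vanishes at `x₀`, the third coordinate has derivative `n * sinQuotDeriv *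
    -- lenDeriv`, with the first two factors nonzero. The second coordinate then gives `v.2 = 0`.
    have hσ : lenDeriv x₀ v = 0 := by
      rw [rowDeriv, hs] at e3
      simp only at e3
      rw [← mul_assoc, hde] at e3
      have : star x₀.1 / n * (v.1 * ((0 : ℝ) : ℂ) + x₀.1 *
          ((sinQuotDeriv (len x₀.1 x₀.2) * lenDeriv x₀ v : ℝ) +
          ((0 / 2 * v.2 : ℝ) : ℂ) * Complex.I)) =
          ((n * (sinQuotDeriv (len x₀.1 x₀.2) * lenDeriv x₀ v) : ℝ) : ℂ) := by
        have hq : star x₀.1 / n * x₀.1 = n := by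
          rw [div_mul_eq_mul_div, hzz, mul_div_assoc, div_self hnC, mul_one]
        push_cast
        linear_combination (sinQuotDeriv (len x₀.1 x₀.2) : ℂ) * lenDeriv x₀ v * hq
      rw [this, Complex.ofReal_re] at e3
      exact (mul_eq_zero.1 ((mul_eq_zero.1 e3).resolve_left hn0.ne')).resolve_left hs'
    have hω : v.2 = 0 := by
      rw [rowDeriv, hσ] at e2
      simp only at e2
      rw [← mul_assoc, hce, Complex.im_ofReal_mul] at e2
      simp only [Complex.add_im, Complex.ofReal_im, Complex.im_ofReal_mul, Complex.I_im, mul_zero,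
        mul_one, zero_add, zero_sub] at e2
      have hC0 : C ≠ 0 := fun h => by simp [h] at hC2
      have := (mul_eq_zero.1 ((mul_eq_zero.1 e2).resolve_left hC0)).resolve_left hs'
      exact (mul_eq_zero.1 (neg_eq_zero.1 this)).resolve_left hr
    have hwd : HasDerivAt (fun t : ℝ => (x₀ + t • v).2) v.2 0 := hl.snd
    have hzd : HasDerivAt (fun t : ℝ => (x₀ + t • v).1) v.1 0 := hl.fst
    have hed : HasDerivAt (fun t : ℝ => expI ((x₀ + t • v).2 / 2)) 0 0 := by
      have := (hasDerivAt_expI ((x₀ + (0 : ℝ) • v).2 / 2)).scomp (0 : ℝ) (hwd.div_const 2)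
      refine this.congr_deriv ?_
      simp [hω]
    have hζd : HasDerivAt (fun t : ℝ => ζ (x₀ + t • v)) (d * (v.1 * expI (x₀.2 / 2))) 0 := by
      refine ((hzd.mul hed).const_mul d).congr_deriv ?_
      simp
    have e1 := ((hasDerivAt_im hζd).div (hasDerivAt_re hζd) (by
      rw [zero_smul, add_zero, hζ0]; simpa using hn0.ne')).unique h1.fst
    rw [zero_smul, add_zero, hζ0] at e1
    have e1' : (d * (v.1 * expI (x₀.2 / 2))).im = 0 := by
      have hn2 : (n : ℝ) ^ 2 ≠ 0 := by positivity
      simp only [Complex.ofReal_re, Complex.ofReal_im, zero_mul, sub_zero] at e1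
      have := (div_eq_zero_iff.1 e1).resolve_right hn2
      exact (mul_eq_zero.1 this).resolve_right hn0.ne'
    have e4 : d * (v.1 * expI (x₀.2 / 2)) = star x₀.1 * v.1 / n := by
      rw [mul_comm v.1, ← mul_assoc, hde]; ring
    rw [e4, Complex.div_ofReal_im, div_eq_zero_iff, or_iff_left hn0.ne'] at e1'
    rw [lenDeriv, hω, mul_zero, add_zero, div_eq_zero_iff, or_iff_left hr] at hσ
    -- The real part vanishes since the length is stationary, the imaginary part by the first
    -- coordinate of `h`.
    have hprod : star x₀.1 * v.1 = 0 := by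
      apply Complex.ext
      · simp; linarith
      · exact e1'
    exact Prod.ext ((mul_eq_zero.1 hprod).resolve_left (star_ne_zero.2 hz)) hω
  have hcoord0 : rowCoord c d (expRow x₀) = 0 := by
    simp only [rowCoord]
    rw [hca0, hrow0]
    simp
  refine expEquivalentAt_of_coord q p hx₀ hc hd (by rw [hca0]; simp)
    -- `rowCoord` lists `Re (d b)` first and `Im (d b)` last; the normal form wants the product, `Im
    -- (d b)`, first.
    (contDiffAt_expRow hr).continuousAt hloc ?_ (isLocDiffeo_linearEquiv swapOuter _) ?_ ?_
  · simp only [h]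
    rw [hζ0, hca0, hrow0]
    simp
  · rw [hcoord0, map_zero]
  · filter_upwards [hU.mem_nhds hx₀U] with x hx
    have hx' : (ζ x).re ≠ 0 := ne_of_gt hx
    simp only [swapOuter_apply, rowCoord, h]
    rw [hdb]
    simp only [Complex.im_ofReal_mul, Complex.re_ofReal_mul]
    ext
    · field_simp
    · rfl
    · rfl

/-! ### Folds along the first stratum -/

/-- The slope `w / r` as a function of the length `r` and of the second entry `β` of the
exponential; `ε = ± 1` is the sign of `w`. -/
def slopeFn (ε : ℝ) (y : ℝ × ℂ) : ℝ :=
  ε * Real.sqrt (1 - Complex.normSq y.2 / Real.sin (y.1 / 2) ^ 2)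

/-- The first entry of the exponential as a function of the length and of the second entry. -/
def entryFn (ε : ℝ) (y : ℝ × ℂ) : ℂ :=
  (Real.cos (y.1 / 2) + Complex.I * (slopeFn ε y * Real.sin (y.1 / 2) : ℝ)) *
    expI (-(y.1 * slopeFn ε y / 2))

/-- The covector as a function of the length and of the second entry of its exponential. -/
def covectorFn (ε : ℝ) (y : ℝ × ℂ) : ℂ × ℝ :=
  (y.2 * expI (-(y.1 * slopeFn ε y / 2)) * (y.1 / Real.sin (y.1 / 2) : ℝ), y.1 * slopeFn ε y)

/-- The domain on which `slopeFn` is smooth. -/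
def slopeDomain : Set (ℝ × ℂ) := {y | Complex.normSq y.2 < Real.sin (y.1 / 2) ^ 2}

theorem isOpen_slopeDomain : IsOpen slopeDomain :=
  isOpen_lt (Complex.continuous_normSq.comp continuous_snd)
    ((Real.continuous_sin.comp (continuous_fst.div_const 2)).pow 2)

theorem sin_ne_zero_of_mem {y : ℝ × ℂ} (hy : y ∈ slopeDomain) : Real.sin (y.1 / 2) ≠ 0 := by
  intro h
  have h1 : Complex.normSq y.2 < Real.sin (y.1 / 2) ^ 2 := hy
  rw [h] at h1
  have := Complex.normSq_nonneg y.2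
  norm_num at h1
  linarith

theorem slope_arg_pos {y : ℝ × ℂ} (hy : y ∈ slopeDomain) :
    0 < 1 - Complex.normSq y.2 / Real.sin (y.1 / 2) ^ 2 := by
  have := sin_ne_zero_of_mem hy
  rw [sub_pos, div_lt_one (by positivity)]
  exact hy

theorem slopeFn_sq {ε : ℝ} (hε : ε * ε = 1) {y : ℝ × ℂ} (hy : y ∈ slopeDomain) :
    slopeFn ε y ^ 2 = 1 - Complex.normSq y.2 / Real.sin (y.1 / 2) ^ 2 := by
  rw [slopeFn, mul_pow, Real.sq_sqrt (slope_arg_pos hy).le, sq ε, hε, one_mul]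

theorem slopeFn_ne_zero {ε : ℝ} (hε : ε * ε = 1) {y : ℝ × ℂ} (hy : y ∈ slopeDomain) :
    slopeFn ε y ≠ 0 := by
  intro h
  have := slopeFn_sq hε hy
  rw [h] at this
  have h2 := slope_arg_pos hy
  rw [← this] at h2
  norm_num at h2

theorem contDiffOn_slopeFn (ε : ℝ) : ContDiffOn ℝ ∞ (slopeFn ε) slopeDomain := by
  intro y hy
  have h1 : ContDiff ℝ ∞ fun y : ℝ × ℂ => Complex.normSq y.2 := by
    have hr : ContDiff ℝ ∞ fun x : ℝ × ℂ => x.2.re := Complex.reCLM.contDiff.comp contDiff_snd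
    have hi : ContDiff ℝ ∞ fun x : ℝ × ℂ => x.2.im := Complex.imCLM.contDiff.comp contDiff_snd
    simp only [Complex.normSq_apply]
    exact (hr.mul hr).add (hi.mul hi)
  have h2 : ContDiff ℝ ∞ fun y : ℝ × ℂ => Real.sin (y.1 / 2) ^ 2 :=
    ((contDiff_fst.div_const 2).sin).pow 2
  exact (contDiffAt_const.mul ((contDiffAt_const.sub (h1.contDiffAt.div h2.contDiffAt
    (pow_ne_zero 2 (sin_ne_zero_of_mem hy)))).sqrt (slope_arg_pos hy).ne')).contDiffWithinAt

theorem contDiffOn_entryFn (ε : ℝ) : ContDiffOn ℝ ∞ (entryFn ε) slopeDomain := by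
  have hk := contDiffOn_slopeFn ε
  have hs : ContDiffOn ℝ ∞ (fun y : ℝ × ℂ => Real.sin (y.1 / 2)) slopeDomain :=
    ((contDiff_fst.div_const 2).sin).contDiffOn
  have hc : ContDiff ℝ ∞ (fun y : ℝ × ℂ => Real.cos (y.1 / 2)) :=
    (contDiff_fst.div_const 2).cos
  have hof : ContDiff ℝ ∞ (fun x : ℝ => (x : ℂ)) := Complex.ofRealCLM.contDiff
  exact ((hof.comp hc).contDiffOn.add (contDiffOn_const.mul
    (hof.comp_contDiffOn (hk.mul hs)))).mul
    (contDiff_expI.comp_contDiffOn ((contDiff_fst.contDiffOn.mul hk).div_const 2).neg)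

theorem contDiffOn_covectorFn (ε : ℝ) : ContDiffOn ℝ ∞ (covectorFn ε) slopeDomain := by
  have hk := contDiffOn_slopeFn ε
  have hs : ContDiffOn ℝ ∞ (fun y : ℝ × ℂ => Real.sin (y.1 / 2)) slopeDomain :=
    ((contDiff_fst.div_const 2).sin).contDiffOn
  have hof : ContDiff ℝ ∞ (fun x : ℝ => (x : ℂ)) := Complex.ofRealCLM.contDiff
  exact ((contDiff_snd.contDiffOn.mul (contDiff_expI.comp_contDiffOn
    ((contDiff_fst.contDiffOn.mul hk).div_const 2).neg)).mul (hof.comp_contDiffOn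
      (contDiff_fst.contDiffOn.div hs fun y hy => sin_ne_zero_of_mem hy))).prodMk
    (contDiff_fst.contDiffOn.mul hk)

/-- The factor of the logarithmic derivative of `entryFn` that does not vanish. -/
def foldFactor (ε : ℝ) (y : ℝ × ℂ) : ℝ :=
  (1 - slopeFn ε y ^ 2) / (4 * slopeFn ε y * Real.sin (y.1 / 2))

theorem contDiffOn_foldFactor {ε : ℝ} (hε : ε * ε = 1) :
    ContDiffOn ℝ ∞ (foldFactor ε) slopeDomain := by
  have hk := contDiffOn_slopeFn ε
  have hs : ContDiffOn ℝ ∞ (fun y : ℝ × ℂ => Real.sin (y.1 / 2)) slopeDomain :=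
    ((contDiff_fst.div_const 2).sin).contDiffOn
  exact (contDiffOn_const.sub (hk.pow 2)).div ((contDiffOn_const.mul hk).mul hs) fun y hy =>
    mul_ne_zero (mul_ne_zero four_ne_zero (slopeFn_ne_zero hε hy)) (sin_ne_zero_of_mem hy)

/-- The relation `|b|² = (1 - k²) sin² (r/2)`, with `k` the slope, removes `b` from the derivative.
-/
theorem hasDerivAt_slopeFn {ε : ℝ} (hε : ε * ε = 1) {y : ℝ × ℂ} (hy : y ∈ slopeDomain) :
    HasDerivAt (fun r => slopeFn ε (r, y.2))
      ((1 - slopeFn ε y ^ 2) * Real.cos (y.1 / 2) / (2 * slopeFn ε y * Real.sin (y.1 / 2))) y.1 := by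
  have hS := sin_ne_zero_of_mem hy
  have hk := slopeFn_ne_zero hε hy
  have hsq := slopeFn_sq hε hy
  have hsin : HasDerivAt (fun r : ℝ => Real.sin (r / 2)) (Real.cos (y.1 / 2) * (1 / 2)) y.1 :=
    ((hasDerivAt_id y.1).div_const 2).sin
  have h1 := ((((hsin.pow 2).fun_inv (pow_ne_zero 2 hS)).const_mul
    (Complex.normSq y.2)).const_sub 1).sqrt (by
      have := (slope_arg_pos hy).ne'
      rwa [div_eq_mul_inv] at this)
  have h2 := h1.const_mul ε
  simp only [← div_eq_mul_inv, Pi.pow_apply] at h2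
  refine h2.congr_deriv ?_
  have hroot : Real.sqrt (1 - Complex.normSq y.2 / Real.sin (y.1 / 2) ^ 2) = ε * slopeFn ε y := by
    rw [slopeFn, ← mul_assoc, hε, one_mul]
  have hε0 : ε ≠ 0 := fun h => by simp [h] at hε
  have hB : Complex.normSq y.2 = (1 - slopeFn ε y ^ 2) * Real.sin (y.1 / 2) ^ 2 := by
    rw [hsq]; field_simp; ring
  rw [hroot, hB]
  field_simp
  ring

/-- For fixed `b` the modulus of `a` is fixed, so `a` can only rotate: its derivative is `i a` times
a real speed, and that speed carries the equation of `C⁰` as a factor. -/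
theorem hasDerivAt_entryFn {ε : ℝ} (hε : ε * ε = 1) {y : ℝ × ℂ} (hy : y ∈ slopeDomain) :
    HasDerivAt (fun r => entryFn ε (r, y.2)) (entryFn ε y * Complex.I *
      (foldFactor ε y * (2 * Real.sin (y.1 / 2) - y.1 * Real.cos (y.1 / 2)) : ℝ)) y.1 := by
  have hS := sin_ne_zero_of_mem hy
  have hk := slopeFn_ne_zero hε hy
  have hkd := hasDerivAt_slopeFn hε hy
  have hsin : HasDerivAt (fun r : ℝ => Real.sin (r / 2)) (Real.cos (y.1 / 2) * (1 / 2)) y.1 :=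
    ((hasDerivAt_id y.1).div_const 2).sin
  have hcos : HasDerivAt (fun r : ℝ => Real.cos (r / 2)) (-Real.sin (y.1 / 2) * (1 / 2)) y.1 :=
    ((hasDerivAt_id y.1).div_const 2).cos
  have he := (hasDerivAt_expI (-(y.1 * slopeFn ε y / 2))).scomp y.1
    (((hasDerivAt_id y.1).mul hkd).div_const 2).neg
  have key := (hcos.ofReal_comp.add ((hkd.mul hsin).ofReal_comp.const_mul Complex.I)).mul he
  refine key.congr_deriv ?_
  simp only [Pi.add_apply, Pi.mul_apply, Function.comp, id, entryFn, foldFactor, Prod.mk.eta,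
    Complex.real_smul, Pi.neg_apply]
  have hk' : (slopeFn ε y : ℂ) ≠ 0 := by exact_mod_cast hk
  have hS' : Complex.sin (y.1 / 2) ≠ 0 := by
    have : ((Real.sin (y.1 / 2) : ℝ) : ℂ) ≠ 0 := by exact_mod_cast hS
    simpa using this
  push_cast
  field_simp
  ring_nf
  simp only [Complex.I_sq]
  ring

/-- On covectors with `w` of sign `ε`, the slope is recovered from the exponential. -/
theorem slopeFn_expRow {ε : ℝ} {x : ℂ × ℝ} (hz : x.1 ≠ 0) (hw : 0 < ε * x.2) (hε : ε * ε = 1)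
    (hS : Real.sin (len x.1 x.2 / 2) ≠ 0) :
    (len x.1 x.2, (expRow x).2) ∈ slopeDomain ∧
      slopeFn ε (len x.1 x.2, (expRow x).2) = x.2 / len x.1 x.2 := by
  have hr := len_ne_zero hz
  have hrpos : 0 < len x.1 x.2 := lt_of_le_of_ne (len_nonneg _ _) hr.symm
  have hsq := len_sq x.1 x.2
  have hB : Complex.normSq (expRow x).2 / Real.sin (len x.1 x.2 / 2) ^ 2 =
      1 - (ε * x.2 / len x.1 x.2) ^ 2 := by
    rw [expRow_eq]
    simp only [Complex.normSq_mul, normSq_expI, Complex.normSq_ofReal, sinQuot]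
    have : Complex.normSq x.1 = len x.1 x.2 ^ 2 - x.2 ^ 2 := by linarith
    rw [this, div_pow, mul_pow, sq ε, hε]
    field_simp
  have hpos : 0 < ε * x.2 / len x.1 x.2 := div_pos hw hrpos
  constructor
  · change Complex.normSq (expRow x).2 < Real.sin (len x.1 x.2 / 2) ^ 2
    rw [← div_lt_one (by positivity), hB]
    have := pow_pos hpos 2
    linarith
  · rw [slopeFn]
    simp only
    rw [hB, sub_sub_cancel, Real.sqrt_sq hpos.le, mul_div_assoc, ← mul_assoc, hε, one_mul]

theorem entryFn_expRow {ε : ℝ} {x : ℂ × ℝ} (hz : x.1 ≠ 0) (hw : 0 < ε * x.2) (hε : ε * ε = 1)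
    (hS : Real.sin (len x.1 x.2 / 2) ≠ 0) :
    entryFn ε (len x.1 x.2, (expRow x).2) = (expRow x).1 := by
  have hr := len_ne_zero hz
  rw [entryFn, (slopeFn_expRow hz hw hε hS).2, expRow_eq]
  simp only [mul_div_cancel₀ _ hr]
  rw [sinQuot, div_mul_eq_mul_div, mul_div_assoc]

/-- Gives the left inverse which shows that `(r, b)` are coordinates on covectors with `z ≠ 0` and
`w` of fixed sign. -/
theorem covectorFn_expRow {ε : ℝ} {x : ℂ × ℝ} (hz : x.1 ≠ 0) (hw : 0 < ε * x.2) (hε : ε * ε = 1)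
    (hS : Real.sin (len x.1 x.2 / 2) ≠ 0) :
    covectorFn ε (len x.1 x.2, (expRow x).2) = x := by
  have hr := len_ne_zero hz
  rw [covectorFn, (slopeFn_expRow hz hw hε hS).2, expRow_eq]
  simp only [mul_div_cancel₀ _ hr]
  have h1 : (sinQuot (len x.1 x.2) : ℂ) *
      (len x.1 x.2 / Real.sin (len x.1 x.2 / 2) : ℝ) = 1 := by
    rw [← Complex.ofReal_mul, sinQuot]
    have : Real.sin (len x.1 x.2 / 2) / len x.1 x.2 *
      (len x.1 x.2 / Real.sin (len x.1 x.2 / 2)) = 1 := by field_simp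
    rw [this, Complex.ofReal_one]
  have h2 := expI_mul_expI_neg (x.2 / 2)
  ext1
  · simp only
    linear_combination x.1 * expI (x.2 / 2) * expI (-(x.2 / 2)) * h1 + x.1 * h2
  · rfl

theorem sin_ne_zero_of_fold {r : ℝ} (hr : r ≠ 0)
    (h : r * Real.cos (r / 2) = 2 * Real.sin (r / 2)) : Real.sin (r / 2) ≠ 0 := by
  intro hS
  rw [hS, mul_zero, mul_eq_zero, or_iff_right hr] at h
  have := Real.sin_sq_add_cos_sq (r / 2)
  rw [hS, h] at this
  norm_num at this

/-- In the coordinates `(r, b)` the map keeps `b` and sends `r` to the position of `a` on its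
circle, which folds at `r₀`. The condition `w ≠ 0` keeps `slopeFn` away from the singularity of the
square root, and `z ≠ 0` keeps `foldFactor` from vanishing. -/
theorem expEquivalentAt_of_mem_C0 (q : SU2) (p : cotangentSpace q) (hp : p ∈ C0 q)
    (hz : (covEquiv q p).1 ≠ 0) (hw : (covEquiv q p).2 ≠ 0) :
    ExpEquivalentAt q p (fun v => (v.1 ^ 2, v.2.1, v.2.2)) := by
  have hfold := hp.2
  rw [covNorm_eq_len] at hfold
  obtain ⟨x₀, hx₀⟩ : ∃ x, covEquiv q p = x := ⟨_, rfl⟩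
  rw [hx₀] at hfold hz hw
  have hr := len_ne_zero hz
  have hS := sin_ne_zero_of_fold hr hfold
  obtain ⟨ε, hε, hεw⟩ : ∃ ε : ℝ, ε * ε = 1 ∧ 0 < ε * x₀.2 := by
    rcases lt_or_gt_of_ne hw with h | h
    · exact ⟨-1, by norm_num, by linarith⟩
    · exact ⟨1, by norm_num, by linarith⟩
  obtain ⟨hmem0, hslope0⟩ := slopeFn_expRow hz hεw hε hS
  have hentry0 := entryFn_expRow hz hεw hε hS
  obtain ⟨r₀, hr₀⟩ : ∃ r, len x₀.1 x₀.2 = r := ⟨_, rfl⟩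
  obtain ⟨a₀, ha₀⟩ : ∃ a, (expRow x₀).1 = a := ⟨_, rfl⟩
  obtain ⟨b₀, hb₀⟩ : ∃ b, (expRow x₀).2 = b := ⟨_, rfl⟩
  rw [hb₀] at hmem0 hslope0 hentry0
  rw [ha₀] at hentry0
  rw [hr₀] at hmem0 hslope0 hentry0 hfold
  have hrlen := hr
  have hSlen := hS
  rw [hr₀] at hr hS
  have hb₀0 : b₀ ≠ 0 := by
    rw [← hb₀, expRow_eq]
    refine mul_ne_zero (mul_ne_zero hz ?_) (expI_ne_zero _)
    rw [hr₀]
    exact_mod_cast div_ne_zero hS hr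
  have ha₀0 : a₀ ≠ 0 := by
    rw [← hentry0, entryFn]
    refine mul_ne_zero (fun h => ?_) (expI_ne_zero _)
    have := congrArg Complex.im h
    simp only [Complex.add_im, Complex.ofReal_im, Complex.I_mul_im, Complex.ofReal_re, zero_add,
      Complex.zero_im] at this
    exact mul_ne_zero (slopeFn_ne_zero hε hmem0) hS this
  set n := ‖a₀‖ with hn
  have hn0 : 0 < n := norm_pos_iff.2 ha₀0
  -- This rotation makes `c * a₀` positive, so `Im (c a)` measures the motion of `a` along its
  -- circle to first order.
  obtain ⟨c, hcdef⟩ : ∃ c : ℂ, star a₀ / n = c := ⟨_, rfl⟩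
  have hc : Complex.normSq c = 1 := by
    rw [← hcdef, Complex.normSq_div, normSq_star, Complex.normSq_ofReal,
      Complex.normSq_eq_norm_sq, ← hn]
    field_simp
  have hca₀ : c * a₀ = n := by
    have hnC : (n : ℂ) ≠ 0 := by exact_mod_cast hn0.ne'
    rw [← hcdef, div_mul_eq_mul_div, mul_comm, mul_star_self, Complex.normSq_eq_norm_sq, ← hn]
    push_cast
    field_simp
  -- the coordinates `(r - r₀, b - b₀)` and the remaining coordinate `τ` of the target
  let ι : ℝ × ℝ × ℝ → ℝ × ℂ := fun y => (r₀ + y.1, b₀ + (y.2.1 + y.2.2 * Complex.I))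
  have hι : ContDiff ℝ ∞ ι := by
    have h1 : ContDiff ℝ ∞ (fun y : ℝ × ℝ × ℝ => (y.2.1 : ℂ)) :=
      Complex.ofRealCLM.contDiff.comp (contDiff_fst.comp contDiff_snd)
    have h2 : ContDiff ℝ ∞ (fun y : ℝ × ℝ × ℝ => (y.2.2 : ℂ)) :=
      Complex.ofRealCLM.contDiff.comp (contDiff_snd.comp contDiff_snd)
    exact (contDiff_const.add contDiff_fst).prodMk
      (contDiff_const.add (h1.add (h2.mul contDiff_const)))
  have hι0 : ι 0 = (r₀, b₀) := by simp [ι]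
  let U : Set (ℝ × ℝ × ℝ) := ι ⁻¹' slopeDomain
  have hU : IsOpen U := isOpen_slopeDomain.preimage hι.continuous
  have h0U : (0 : ℝ × ℝ × ℝ) ∈ U := by
    change ι 0 ∈ slopeDomain
    rw [hι0]; exact hmem0
  let τ : ℝ × ℝ × ℝ → ℝ := fun y => (c * entryFn ε (ι y)).im
  let G : ℝ × ℝ × ℝ → ℝ := fun y => (c * entryFn ε (ι y)).re * foldFactor ε (ι y)
  let τ₁ : ℝ × ℝ × ℝ → ℝ := fun y =>
    G y * (2 * Real.sin ((r₀ + y.1) / 2) - (r₀ + y.1) * Real.cos ((r₀ + y.1) / 2))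
  have hentry : ContDiffOn ℝ ∞ (fun y => c * entryFn ε (ι y)) U :=
    contDiffOn_const.mul ((contDiffOn_entryFn ε).comp hι.contDiffOn fun y hy => hy)
  have hτ : ContDiffOn ℝ ∞ τ U := Complex.imCLM.contDiff.comp_contDiffOn hentry
  have hG : ContDiffOn ℝ ∞ G U := (Complex.reCLM.contDiff.comp_contDiffOn hentry).mul
    ((contDiffOn_foldFactor hε).comp hι.contDiffOn fun y hy => hy)
  have hτ₁ : ContDiffOn ℝ ∞ τ₁ U := by
    have h1 : ContDiff ℝ ∞ fun y : ℝ × ℝ × ℝ => r₀ + y.1 := contDiff_const.add contDiff_fst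
    exact hG.mul ((contDiff_const.mul (h1.div_const 2).sin).sub
      (h1.mul (h1.div_const 2).cos)).contDiffOn
  have hτd : ∀ y ∈ U, HasDerivAt (fun x => τ (x, y.2)) (τ₁ y) y.1 := by
    intro y hy
    have h1 := hasDerivAt_entryFn hε (y := ι y) hy
    have h2 : HasDerivAt (fun x : ℝ => r₀ + x) 1 y.1 := (hasDerivAt_id _).const_add r₀
    have h3 : HasDerivAt (fun x : ℝ => c * entryFn ε (r₀ + x, (ι y).2)) _ y.1 :=
      (h1.scomp y.1 h2).const_mul c
    refine (hasDerivAt_im h3).congr_deriv ?_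
    rw [one_smul, ← mul_assoc, ← mul_assoc, Complex.im_mul_ofReal, Complex.mul_I_im]
    simp only [τ₁, G, mul_assoc]
    rfl
  obtain ⟨s, X, V, m, hs, hV, h0V, hVU, hX, hm, hX0, hXd, hXsq⟩ :=
    exists_sq_eq_of_fold (E := ℝ × ℝ) (τ := τ) (τ₁ := τ₁) hU h0U hτ₁ hτd
      -- The bracket in `τ₁` vanishes at `r₀` and has derivative `r₀ / 2 * sin (r₀ / 2)` there, so
      -- `G` need not be differentiated explicitly.
      (d := G 0 * (r₀ / 2 * Real.sin (r₀ / 2)))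
      (fun Y _ => by simp only [τ₁, add_zero, hfold, sub_self, mul_zero])
      (by
        refine mul_ne_zero (mul_ne_zero ?_ ?_) (mul_ne_zero (div_ne_zero hr two_ne_zero) hS)
        · rw [hι0, hentry0, hca₀, Complex.ofReal_re]; exact hn0.ne'
        · rw [hι0]
          refine div_ne_zero ?_
            (mul_ne_zero (mul_ne_zero four_ne_zero (slopeFn_ne_zero hε hmem0)) hS)
          rw [slopeFn_sq hε hmem0, sub_sub_cancel]
          exact div_ne_zero (by simpa using hb₀0) (pow_ne_zero 2 hS))
      (by
        have hGd : DifferentiableAt ℝ (fun x : ℝ => G (x, 0)) 0 := by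
          have : DifferentiableAt ℝ G ((0 : ℝ), (0 : ℝ × ℝ)) :=
            (hG.contDiffAt (hU.mem_nhds h0U)).differentiableAt (by simp)
          exact DifferentiableAt.comp (g := G) (f := fun x : ℝ => (x, (0 : ℝ × ℝ))) 0 this
            (by fun_prop)
        have hl : HasDerivAt (fun x : ℝ => r₀ + x) 1 0 := (hasDerivAt_id _).const_add r₀
        have h1 := hGd.hasDerivAt.mul (((hl.div_const 2).sin.const_mul 2).sub
          (hl.mul (hl.div_const 2).cos))
        refine h1.congr_deriv ?_
        simp only [Pi.sub_apply, Pi.mul_apply, add_zero, hfold, sub_self, mul_zero, zero_add,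
          Prod.mk_zero_zero]
        ring)
  let K : ℂ × ℝ → ℝ × ℝ × ℝ := fun x =>
    (len x.1 x.2 - r₀, (expRow x).2.re - b₀.re, (expRow x).2.im - b₀.im)
  have hK0 : K x₀ = 0 := by simp [K, hr₀, hb₀]
  have hιK : ∀ x, ι (K x) = (len x.1 x.2, (expRow x).2) := by
    intro x
    ext1
    · simp [ι, K]
    · apply Complex.ext <;> simp [ι, K]
  let O : Set (ℂ × ℝ) := {x | x.1 ≠ 0 ∧ 0 < ε * x.2}
  have hO : IsOpen O := (isOpen_ne_fun continuous_fst continuous_const).inter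
    (isOpen_lt continuous_const (continuous_const.mul continuous_snd))
  have hx₀O : x₀ ∈ O := ⟨hz, hεw⟩
  have hK : ContDiffOn ℝ ∞ K O := by
    intro x hx
    have h1 := contDiffAt_len (len_ne_zero hx.1)
    have h2 := (contDiffAt_expRow (len_ne_zero hx.1)).snd
    exact ((h1.sub contDiffAt_const).prodMk
      (((Complex.reCLM.contDiff.contDiffAt.comp x h2).sub contDiffAt_const).prodMk
        ((Complex.imCLM.contDiff.contDiffAt.comp x h2).sub contDiffAt_const))).contDiffWithinAt
  have hev : ∀ᶠ x in 𝓝 x₀, x ∈ O ∧ Real.sin (len x.1 x.2 / 2) ≠ 0 := by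
    have h1 : ∀ᶠ x in 𝓝 x₀, x ∈ O := hO.mem_nhds hx₀O
    refine h1.and ?_
    have : ContinuousAt (fun x : ℂ × ℝ => Real.sin (len x.1 x.2 / 2)) x₀ :=
      Real.continuous_sin.continuousAt.comp ((contDiffAt_len hrlen).continuousAt.div_const 2)
    exact this.eventually_ne hSlen
  have hKloc : IsLocDiffeo K x₀ := by
    refine isLocDiffeo_of_leftInverse (by simp) hO hx₀O hK (g := fun y => covectorFn ε (ι y)) ?_ ?_
    · rw [hK0]
      have h1 : ContDiffOn ℝ ∞ (fun y => covectorFn ε (ι y)) U :=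
        (contDiffOn_covectorFn ε).comp hι.contDiffOn fun y hy => hy
      exact (h1.contDiffAt (hU.mem_nhds h0U)).differentiableAt (by simp)
    · filter_upwards [hev] with x hx
      rw [hιK, covectorFn_expRow hx.1.1 hx.1.2 hε hx.2]
  have hFloc : IsLocDiffeo (fun y : ℝ × ℝ × ℝ => (X y, y.2)) (K x₀) := by
    rw [hK0]
    have hFs : ContDiffOn ℝ ∞ (fun y : ℝ × ℝ × ℝ => (X y, y.2)) V :=
      hX.prodMk contDiff_snd.contDiffOn
    refine isLocDiffeo_of_injective rfl hV h0V hFs fun v hv => ?_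
    have hd := ((hFs.contDiffAt (hV.mem_nhds h0V)).differentiableAt (by simp)).hasFDerivAt
    have hd0 : HasFDerivAt (fun y : ℝ × ℝ × ℝ => (X y, y.2)) (fderiv ℝ (fun y => (X y, y.2)) 0)
        (0 + (0 : ℝ) • v) := by rwa [zero_smul, add_zero]
    have hl := hasDerivAt_line 0 v
    have h1 := hd0.comp_hasDerivAt 0 hl
    rw [hv] at h1
    have h5 : HasDerivAt (fun t : ℝ => (0 + t • v).2) v.2 0 := hl.snd
    have hv2 : v.2 = 0 := h5.unique h1.snd
    have hXv : HasDerivAt (fun t : ℝ => X (t * v.1, 0)) (m * v.1) 0 := by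
      have h2 : HasDerivAt (fun t : ℝ => t * v.1) v.1 0 := by
        simpa using (hasDerivAt_id (0 : ℝ)).mul_const v.1
      have h3 : HasDerivAt (fun x => X (x, 0)) m (0 * v.1) := by rwa [zero_mul]
      exact h3.comp (0 : ℝ) h2
    -- Since `v.2 = 0`, the derivative of `X` along the first axis suffices.
    have hcurve : (fun t : ℝ => X (0 + t • v)) = fun t => X (t * v.1, 0) := by
      funext t
      rw [zero_add]
      congr 1
      exact Prod.ext rfl (by simp [hv2])
    have h4 : HasDerivAt (fun t : ℝ => X (0 + t • v)) 0 0 := h1.fst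
    rw [hcurve] at h4
    exact Prod.ext ((mul_eq_zero.1 (hXv.unique h4)).resolve_left hm) hv2
  -- `sh` reads `b - b₀` off the target and sets `r = r₀`, so `τ (sh t)` is the critical value of
  -- the fold; `θ` subtracts it and rescales by `s`.
  let sh : ℝ × ℝ × ℝ → ℝ × ℝ × ℝ := fun t => (0, t.1 - b₀.re, t.2.2 - b₀.im)
  have hsh : ContDiff ℝ ∞ sh := by fun_prop
  let θ : ℝ × ℝ × ℝ → ℝ × ℝ × ℝ := fun t => (s * (t.2.1 - τ (sh t)), (sh t).2)
  have hcoord0 : rowCoord c 1 (expRow x₀) = (b₀.re, 0, b₀.im) := by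
    rw [rowCoord, ha₀, hb₀, hca₀, one_mul, Complex.ofReal_im]
  have hsh0 : sh (b₀.re, 0, b₀.im) = 0 := by simp [sh]
  have hτ0 : τ 0 = 0 := by
    simp only [τ]
    rw [hι0, hentry0, hca₀, Complex.ofReal_im]
  have hθ0 : θ (b₀.re, 0, b₀.im) = 0 := by
    simp only [θ]
    rw [hsh0, hτ0]
    simp
  have hθloc : IsLocDiffeo θ (b₀.re, 0, b₀.im) := by
    refine isLocDiffeo_of_leftInverse rfl (hU.preimage hsh.continuous)
      (by rw [mem_preimage, hsh0]; exact h0U)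
      (g := fun y => (y.2.1 + b₀.re, y.1 / s + τ (0, y.2), y.2.2 + b₀.im)) ?_ ?_ ?_
    · exact (contDiffOn_const.mul ((contDiff_fst.comp contDiff_snd).contDiffOn.sub
        (hτ.comp hsh.contDiffOn fun y hy => hy))).prodMk (contDiff_snd.comp hsh).contDiffOn
    · rw [hθ0]
      have h1 : DifferentiableAt ℝ τ ((0 : ℝ), (0 : ℝ × ℝ × ℝ).2) :=
        (hτ.contDiffAt (hU.mem_nhds h0U)).differentiableAt (by simp)
      have h2 : DifferentiableAt ℝ (fun y : ℝ × ℝ × ℝ => τ (0, y.2)) 0 :=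
        DifferentiableAt.comp (g := τ) (f := fun y : ℝ × ℝ × ℝ => ((0 : ℝ), y.2)) 0 h1
          (by fun_prop)
      have h3 : DifferentiableAt ℝ (fun y : ℝ × ℝ × ℝ => y.1 / s) 0 := by fun_prop
      have h4 : DifferentiableAt ℝ (fun y : ℝ × ℝ × ℝ => y.2.1 + b₀.re) 0 := by fun_prop
      have h5 : DifferentiableAt ℝ (fun y : ℝ × ℝ × ℝ => y.2.2 + b₀.im) 0 := by fun_prop
      exact h4.prodMk ((h3.add h2).prodMk h5)
    · refine Eventually.of_forall fun t => ?_
      have : ((0 : ℝ), (sh t).2) = sh t := rfl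
      simp only [θ, this, mul_div_cancel_left₀ _ hs]
      simp [sh]
  have hKc : ContinuousAt K x₀ := (hK.contDiffAt (hO.mem_nhds hx₀O)).continuousAt
  have hKV : ∀ᶠ x in 𝓝 x₀, K x ∈ V :=
    hKc.eventually (by rw [hK0]; exact hV.mem_nhds h0V)
  refine expEquivalentAt_of_coord q p hx₀ hc (d := 1) (by simp)
    (by rw [ha₀, hca₀, Complex.ofReal_re]; exact hn0)
    (contDiffAt_expRow hrlen).continuousAt (hFloc.comp hKloc) ?_
    (by rw [hcoord0]; exact hθloc) (by rw [hcoord0, hθ0]) ?_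
  · simp only [Function.comp]
    rw [hK0]
    exact Prod.ext (hX0 0) rfl
  · filter_upwards [hev, hKV] with x hx hxV
    have h1 : τ (K x) = (c * (expRow x).1).im := by
      simp only [τ]
      rw [hιK, entryFn_expRow hx.1.1 hx.1.2 hε hx.2]
    have h2 : sh (rowCoord c 1 (expRow x)) = (0, (K x).2) := by
      simp only [sh, rowCoord, one_mul, K]
    change (s * ((c * (expRow x).1).im - τ (sh (rowCoord c 1 (expRow x)))),
      (sh (rowCoord c 1 (expRow x))).2) = (X (K x) ^ 2, (K x).2.1, (K x).2.2)
    rw [h2, ← h1, hXsq _ hxV]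

/-! ### Density of the fold points -/

/-- The points of the first stratum off the poles and the equator. -/
def foldPoints (q : SU2) : Set (cotangentSpace q) :=
  {p | p ∈ C0 q ∧ (covEquiv q p).1 ≠ 0 ∧ (covEquiv q p).2 ≠ 0}

/-- Off the origin, membership in `C0` depends only on the length, so a curve on the sphere through
`p` stays in `C0`. -/
theorem mem_closure_foldPoints (q : SU2) {p : cotangentSpace q} (hp : p ∈ C0 q)
    {γ : ℝ → ℂ × ℝ} (hγ : Continuous γ) (h0 : γ 0 = covEquiv q p)
    (hlen : ∀ t, len (γ t).1 (γ t).2 = len (covEquiv q p).1 (covEquiv q p).2)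
    (hne : ∀ t ∈ Ioo (0 : ℝ) 1, (γ t).1 ≠ 0 ∧ (γ t).2 ≠ 0) : p ∈ closure (foldPoints q) := by
  have hc : Continuous fun t => (covEquiv q).symm (γ t) := (covEquiv q).symm.continuous.comp hγ
  have ht : Tendsto (fun t => (covEquiv q).symm (γ t)) (𝓝[>] 0) (𝓝 p) := by
    have h1 := hc.tendsto 0
    rw [h0, ContinuousLinearEquiv.symm_apply_apply] at h1
    exact h1.mono_left nhdsWithin_le_nhds
  refine mem_closure_of_tendsto ht ?_
  filter_upwards [Ioo_mem_nhdsGT (zero_lt_one' ℝ)] with t ht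
  have hx := hne t ht
  refine ⟨⟨fun h => hx.1 ?_, ?_⟩, ?_⟩
  · have := (ContinuousLinearEquiv.symm_apply_eq _).1 h
    rw [this, map_zero]
    rfl
  · rw [covNorm_eq_len, ContinuousLinearEquiv.apply_symm_apply, hlen, ← covNorm_eq_len]
    exact hp.2
  · rw [ContinuousLinearEquiv.apply_symm_apply]
    exact hx

theorem C0_subset_closure_foldPoints (q : SU2) : C0 q ⊆ closure (foldPoints q) := by
  intro p hp
  obtain ⟨⟨z, w⟩, hx⟩ : ∃ x, covEquiv q p = x := ⟨_, rfl⟩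
  have hsin : ∀ t ∈ Ioo (0 : ℝ) 1, Real.sin t ≠ 0 := fun t ht =>
    (Real.sin_pos_of_pos_of_lt_pi ht.1 (ht.2.trans (by linarith [Real.pi_gt_three]))).ne'
  have hcos : ∀ t ∈ Ioo (0 : ℝ) 1, Real.cos t ≠ 0 := fun t ht =>
    (Real.cos_pos_of_le_one (abs_le.2 ⟨by linarith [ht.1], ht.2.le⟩)).ne'
  have hx0 : ¬(z = 0 ∧ w = 0) := by
    rintro ⟨rfl, rfl⟩
    exact hp.1 ((covEquiv q).map_eq_zero_iff.1 hx)
  by_cases hz : z = 0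
  · subst hz
    have hw : w ≠ 0 := fun h => hx0 ⟨rfl, h⟩
    -- From a pole, move along a meridian towards the equator; the case `w = 0` moves from the
    -- equator towards a pole. The interval `(0, 1)` lies inside `(0, π/2)`, where sine and cosine
    -- are nonzero.
    refine mem_closure_foldPoints q hp
      (γ := fun t => (((w * Real.sin t : ℝ) : ℂ), w * Real.cos t)) ?_ ?_ ?_ ?_
    · exact (Complex.continuous_ofReal.comp (continuous_const.mul Real.continuous_sin)).prodMk
        (continuous_const.mul Real.continuous_cos)
    · rw [hx]; simp
    · intro t
      rw [hx, len, len, Complex.normSq_ofReal, Complex.normSq_zero]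
      congr 1
      linear_combination w ^ 2 * Real.sin_sq_add_cos_sq t
    · intro t ht
      exact ⟨Complex.ofReal_ne_zero.2 (mul_ne_zero hw (hsin t ht)), mul_ne_zero hw (hcos t ht)⟩
  by_cases hw : w = 0
  · subst hw
    refine mem_closure_foldPoints q hp
      (γ := fun t => (z * (Real.cos t : ℝ), ‖z‖ * Real.sin t)) ?_ ?_ ?_ ?_
    · exact (continuous_const.mul (Complex.continuous_ofReal.comp Real.continuous_cos)).prodMk
        (continuous_const.mul Real.continuous_sin)
    · rw [hx]; simp
    · intro t
      rw [hx, len, len, Complex.normSq_mul, Complex.normSq_ofReal, Complex.normSq_eq_norm_sq]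
      congr 1
      linear_combination ‖z‖ ^ 2 * Real.sin_sq_add_cos_sq t
    · intro t ht
      exact ⟨mul_ne_zero hz (Complex.ofReal_ne_zero.2 (hcos t ht)),
        mul_ne_zero (norm_ne_zero_iff.2 hz) (hsin t ht)⟩
  · exact subset_closure ⟨hp, by rw [hx]; exact hz, by rw [hx]; exact hw⟩

theorem C0_nonempty (q : SU2) : (C0 q).Nonempty := by
  have hpi := Real.pi_pos
  -- The function equals `-2π` and `2` at the endpoints, and the interval avoids the trivial root `r
  -- = 0`.
  obtain ⟨r, hr, hr0⟩ : ∃ r ∈ Icc (2 * Real.pi) (3 * Real.pi),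
      r * Real.cos (r / 2) - 2 * Real.sin (r / 2) = 0 := by
    have hcont : ContinuousOn (fun r : ℝ => r * Real.cos (r / 2) - 2 * Real.sin (r / 2))
        (Icc (2 * Real.pi) (3 * Real.pi)) := by fun_prop
    refine intermediate_value_Icc (by linarith) hcont ⟨?_, ?_⟩
    · have : 2 * Real.pi / 2 = Real.pi := by ring
      rw [this, Real.cos_pi, Real.sin_pi]
      linarith
    · have : 3 * Real.pi / 2 = Real.pi / 2 + Real.pi := by ring
      rw [this, Real.cos_add_pi, Real.sin_add_pi, Real.cos_pi_div_two, Real.sin_pi_div_two]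
      norm_num
  have hrpos : 0 < r := lt_of_lt_of_le (by linarith) hr.1
  refine ⟨(covEquiv q).symm ((r : ℂ), 0), fun h => ?_, ?_⟩
  · have := (ContinuousLinearEquiv.symm_apply_eq _).1 h
    rw [map_zero] at this
    exact hrpos.ne' (Complex.ofReal_eq_zero.1 (congrArg Prod.fst this))
  · rw [covNorm_eq_len, ContinuousLinearEquiv.apply_symm_apply, len, Complex.normSq_ofReal,
      zero_pow two_ne_zero, add_zero, Real.sqrt_mul_self hrpos.le]
    linarith

theorem foldPoints_nonempty (q : SU2) : (foldPoints q).Nonempty :=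
  closure_nonempty_iff.1 ((C0_nonempty q).mono (C0_subset_closure_foldPoints q))

end

end SRSU2

/-! ### The theorem -/

theorem mainTheorem5 (q : SU2) :
    SRSU2.expDomain q = Set.univ ∧
    (∀ p : SRSU2.cotangentSpace q, SRSU2.hamiltonian ((q : Mat2), (p : Mat2)) ≠ 0 →
      (p ∈ SRSU2.conjugateLocus q ↔ p ∈ SRSU2.C0 q ∪ SRSU2.C1 q)) ∧
    (∃ D : Set (SRSU2.cotangentSpace q), D ⊆ SRSU2.C0 q ∧ D.Nonempty ∧
      SRSU2.C0 q ⊆ closure D ∧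
      ∀ p ∈ D, SRSU2.ExpEquivalentAt q p (fun v => (v.1 ^ 2, v.2.1, v.2.2))) ∧
    (∀ p ∈ SRSU2.C1 q, SRSU2.hamiltonian ((q : Mat2), (p : Mat2)) ≠ 0 →
      SRSU2.ExpEquivalentAt q p (fun v => (v.1 * v.2.2, v.2.1, v.2.2))) :=
  ⟨SRSU2.expDomain_eq_univ q,
    fun p hp => SRSU2.mem_conjugateLocus_iff_mem_strata q p
      ((SRSU2.hamiltonian_ne_zero_iff q p).1 hp),
    ⟨SRSU2.foldPoints q, fun _ hp => hp.1, SRSU2.foldPoints_nonempty q,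
      SRSU2.C0_subset_closure_foldPoints q,
      fun p hp => SRSU2.expEquivalentAt_of_mem_C0 q p hp.1 hp.2.1 hp.2.2⟩,
    fun p hp hH => SRSU2.expEquivalentAt_of_mem_C1 q p hp
      ((SRSU2.hamiltonian_ne_zero_iff q p).1 hH)⟩
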